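/- **Setting.** Let $f:\mathbb{R}^{d_1}\times\mathbb{R}^{d_2}\to\mathbb{R}$ be differentiable, let $l,\mu>0$ and $\kappa=l/\mu$. Assume (with Euclidean norms): (1) for $\nabla_\bullet\in\{\nabla_x,\nabla_y\}$ and all points, $\|\nabla_\bullet f(x_1,y_1)-\nabla_\bullet f(x_2,y_2)\|\le l(\|x_1-x_2\|+\|y_1-y_2\|)$; (2) for every $x$ the function $f(x,\cdot)$ attains its maximum $\Phi(x)=\max_y f(x,y)$, and $\|\nabla_y f(x,y)\|^2\ge 2\mu(\Phi(x)-f(x,y))$ for all $x,y$. A point $(x,y)$ is $(\epsilon_1,\epsilon_2)$-stationary for $f$ if $\|\nabla_xf(x,y)\|\le\epsilon_1$ and $\|\nabla_yf(x,y)\|\le\epsilon_2$ ($\epsilon$-stationary if $\epsilon_1=\epsilon_2=\epsilon$); $x$ is $\epsilon$-stationary for $\Phi$ if $\Phi$ is differentiable and $\|\nabla\Phi(x)\|\le\epsilon$. For random points, stationarity is meant in mean square: $\mathbb{E}\|\nabla\cdot\|^2\le\epsilon^2$ in place of $\|\nabla\cdot\|\le\epsilon$. In the stochastic statements, $G_x(x,y,\xi)$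 and $G_y(x,y,\xi)$, where $\xi$ has a fixed law, are (jointly measurable) unbiased estimators of $\nabla_xf(x,y)$ and $\nabla_yf(x,y)$ with $\mathbb{E}\|G_x-\nabla_xf\|^2\le\sigma^2$ and $\mathbb{E}\|G_y-\nabla_yf\|^2\le\sigma^2$, $\sigma\ge0$, and all samples drawn by an algorithm are i.i.d. with that law. Write $\log^+t=\max\{0,\log|t|\}$ (with $\log^+0=0$). **Proposition 1.** Under (1) and (2), $\Phi$ is differentiable. Moreover, there is an absolute constant $C>0$ such that for all $l,\mu>0$ and $\epsilon>0$ the following hold; the step sizes and the iteration number $K$ below depend only on $l,\mu,\epsilon$ and, where they appear, $\epsilon'$ and $\sigma$, not on $f$, the dimensions, the points, or the stochastic oracle. (a) Let $\hat x$ be $\epsilon$-stationary for $\Phi$ and $\|\nabla_yf(\hat x,\tilde y)\|\le\epsilon'$. * Gradient ascent $y^0=\tilde y$, $y^{k+1}=y^k+\tau\nabla_yf(\hat x,y^k)$, with a suitable step size $\tau>0$: there is $K\le C\,\kappa\log^+(\kappa\epsilon'/\epsilon)$ such that $(\hat x,y^k)$ is a $C\epsilon$-stationary point of $f$ for every $k\ge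 K$. Thus $K$ gradients suffice. * Stochastic gradient ascent $y^0=\tilde y$, $y^{k+1}=y^k+\tau G_y(\hat x,y^k,\xi^k)$, with a suitable step size $\tau>0$: there is $K\le C\,(\kappa+\kappa^3\sigma^2\epsilon^{-2})\log^+(\kappa\epsilon'/\epsilon)$ such that $(\hat x,y^k)$ is, in mean square, a $C\epsilon$-stationary point of $f$ for every $k\ge K$. Thus $K=\tilde O(\kappa+\kappa^3\sigma^2\epsilon^{-2})$ stochastic gradients suffice. (b) Let $(\tilde x,\tilde y)$ be $(\epsilon,\epsilon/\sqrt\kappa)$-stationary for $f$, and let $\hat f(x,y)=f(x,y)+l\|x-\tilde x\|^2$. * AGDA on $\hat f$: $(x^0,y^0)=(\tilde x,\tilde y)$, $y^{k+1}=y^k+\tau_2\nabla_y\hat f(x^k,y^k)$, $x^{k+1}=x^k-\tau_1\nabla_x\hat f(x^k,y^{k+1})$, with suitable step sizes $\tau_1,\tau_2>0$: there is $K$ with $2K\le C\,\kappa\log^+\kappa$ such that $x^k$ is a $C\epsilon$-stationary point of $\Phi$ for every $k\ge K$. Thus $2K$ gradients suffice. * Stochastic AGDA on $\hat f$: $(x^0,y^0)=(\tilde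 x,\tilde y)$, $y^{k+1}=y^k+\tau_2G_y(x^k,y^k,\xi_1^k)$, $x^{k+1}=x^k-\tau_1[G_x(x^k,y^{k+1},\xi_2^k)+2l(x^k-\tilde x)]$, with suitable step sizes $\tau_1,\tau_2>0$: there is $K$ with $2K\le C\,(\kappa+\kappa^5\sigma^2\epsilon^{-2})\log^+\kappa$ such that $x^k$ is, in mean square, a $C\epsilon$-stationary point of $\Phi$ for every $k\ge K$. Thus $2K=\tilde O(\kappa+\kappa^5\sigma^2\epsilon^{-2})$ stochastic gradients suffice. -/

import Mathlib

open MeasureTheory ProbabilityTheory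

noncomputable section

/-- Euclidean space `ℝ^d` with the `ℓ²` norm. -/
abbrev Euc (d : ℕ) : Type := EuclideanSpace ℝ (Fin d)

/-- The partial gradient `∇ₓ f(x, y)`. -/
def gradX {d₁ d₂ : ℕ} (f : Euc d₁ → Euc d₂ → ℝ) (x : Euc d₁) (y : Euc d₂) : Euc d₁ :=
  gradient (fun x' => f x' y) x

/-- The partial gradient `∇_y f(x, y)`. -/
def gradY {d₁ d₂ : ℕ} (f : Euc d₁ → Euc d₂ → ℝ) (x : Euc d₁) (y : Euc d₂) : Euc d₂ :=
  gradient (fun y' => f x y') y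

/-- The primal function `Φ(x) = max_y f(x, y)`; the supremum is a maximum as soon as it is
attained, which is part of `PLCondition`. -/
def primal {d₁ d₂ : ℕ} (f : Euc d₁ → Euc d₂ → ℝ) (x : Euc d₁) : ℝ :=
  ⨆ y, f x y

/-- `f` is differentiable and its two partial gradients are Lipschitz with constant `l > 0`. -/
structure LipschitzSmooth {d₁ d₂ : ℕ} (f : Euc d₁ → Euc d₂ → ℝ) (l : ℝ) : Prop where
  pos : 0 < l
  differentiable : Differentiable ℝ (fun p : Euc d₁ × Euc d₂ => f p.1 p.2)
  lipschitz_gradX : ∀ x₁ x₂ y₁ y₂,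
    ‖gradX f x₁ y₁ - gradX f x₂ y₂‖ ≤ l * (‖x₁ - x₂‖ + ‖y₁ - y₂‖)
  lipschitz_gradY : ∀ x₁ x₂ y₁ y₂,
    ‖gradY f x₁ y₁ - gradY f x₂ y₂‖ ≤ l * (‖x₁ - x₂‖ + ‖y₁ - y₂‖)

/-- For every `x` the function `f(x, ·)` attains its maximum, and it satisfies the
Polyak-Łojasiewicz inequality with constant `μ > 0`. -/
structure PLCondition {d₁ d₂ : ℕ} (f : Euc d₁ → Euc d₂ → ℝ) (μ : ℝ) : Prop where
  pos : 0 < μ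
  exists_max : ∀ x, ∃ y₀, ∀ y, f x y ≤ f x y₀
  pl : ∀ x y, 2 * μ * (primal f x - f x y) ≤ ‖gradY f x y‖ ^ 2

/-- `(x, y)` is an `(ε₁, ε₂)`-stationary point of `f`. -/
def IsStationaryPair {d₁ d₂ : ℕ} (f : Euc d₁ → Euc d₂ → ℝ) (ε₁ ε₂ : ℝ)
    (x : Euc d₁) (y : Euc d₂) : Prop :=
  ‖gradX f x y‖ ≤ ε₁ ∧ ‖gradY f x y‖ ≤ ε₂

/-- `x` is an `ε`-stationary point of the differentiable function `Φ`. -/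
def IsStationaryPt {d : ℕ} (Φ : Euc d → ℝ) (ε : ℝ) (x : Euc d) : Prop :=
  Differentiable ℝ Φ ∧ ‖gradient Φ x‖ ≤ ε

/-- The random point `(X, Y)` is, in mean square, an `(ε₁, ε₂)`-stationary point of `f`:
`𝔼‖∇ₓ f(X, Y)‖² ≤ ε₁²` and `𝔼‖∇_y f(X, Y)‖² ≤ ε₂²`. -/
def IsMeanStationaryPair {d₁ d₂ : ℕ} {Ω : Type*} [MeasurableSpace Ω] (Q : Measure Ω)
    (f : Euc d₁ → Euc d₂ → ℝ) (ε₁ ε₂ : ℝ) (X : Ω → Euc d₁) (Y : Ω → Euc d₂) : Prop :=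
  (Integrable (fun ω => ‖gradX f (X ω) (Y ω)‖ ^ 2) Q ∧
    ∫ ω, ‖gradX f (X ω) (Y ω)‖ ^ 2 ∂Q ≤ ε₁ ^ 2) ∧
  (Integrable (fun ω => ‖gradY f (X ω) (Y ω)‖ ^ 2) Q ∧
    ∫ ω, ‖gradY f (X ω) (Y ω)‖ ^ 2 ∂Q ≤ ε₂ ^ 2)

/-- The random point `X` is, in mean square, an `ε`-stationary point of the differentiable
function `Φ`: `𝔼‖∇Φ(X)‖² ≤ ε²`. -/
def IsMeanStationary {d : ℕ} {Ω : Type*} [MeasurableSpace Ω] (Q : Measure Ω)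
    (Φ : Euc d → ℝ) (ε : ℝ) (X : Ω → Euc d) : Prop :=
  Differentiable ℝ Φ ∧ Integrable (fun ω => ‖gradient Φ (X ω)‖ ^ 2) Q ∧
    ∫ ω, ‖gradient Φ (X ω)‖ ^ 2 ∂Q ≤ ε ^ 2

/-- `Gx(x, y, ξ)` and `Gy(x, y, ξ)`, with `ξ` of law `P`, are unbiased estimators of
`∇ₓ f(x, y)` and `∇_y f(x, y)` whose variances are at most `σ²`. -/
structure StochasticGradients {d₁ d₂ : ℕ} (f : Euc d₁ → Euc d₂ → ℝ) {Ξ : Type*}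
    [MeasurableSpace Ξ] (P : Measure Ξ) (Gx : Euc d₁ → Euc d₂ → Ξ → Euc d₁)
    (Gy : Euc d₁ → Euc d₂ → Ξ → Euc d₂) (σ : ℝ) : Prop where
  measurable_Gx : Measurable (fun p : Euc d₁ × Euc d₂ × Ξ => Gx p.1 p.2.1 p.2.2)
  measurable_Gy : Measurable (fun p : Euc d₁ × Euc d₂ × Ξ => Gy p.1 p.2.1 p.2.2)
  integrable_Gx : ∀ x y, Integrable (Gx x y) P
  integrable_Gy : ∀ x y, Integrable (Gy x y) P
  unbiased_Gx : ∀ x y, ∫ ξ, Gx x y ξ ∂P = gradX f x y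
  unbiased_Gy : ∀ x y, ∫ ξ, Gy x y ξ ∂P = gradY f x y
  integrable_sq_Gx : ∀ x y, Integrable (fun ξ => ‖Gx x y ξ - gradX f x y‖ ^ 2) P
  integrable_sq_Gy : ∀ x y, Integrable (fun ξ => ‖Gy x y ξ - gradY f x y‖ ^ 2) P
  variance_Gx : ∀ x y, ∫ ξ, ‖Gx x y ξ - gradX f x y‖ ^ 2 ∂P ≤ σ ^ 2
  variance_Gy : ∀ x y, ∫ ξ, ‖Gy x y ξ - gradY f x y‖ ^ 2 ∂P ≤ σ ^ 2

/-- The samples `ξ i` are independent and all have law `P`. -/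
structure IIDSamples {ι Ω Ξ : Type*} [MeasurableSpace Ω] [MeasurableSpace Ξ]
    (Q : Measure Ω) (P : Measure Ξ) (ξ : ι → Ω → Ξ) : Prop where
  measurable : ∀ i, Measurable (ξ i)
  law : ∀ i, Q.map (ξ i) = P
  indep : iIndepFun ξ Q

/-- Gradient ascent on `f(x, ·)` with step size `τ` from `y₀`.
One iteration evaluates one gradient. -/
def gradientAscent {d₁ d₂ : ℕ} (f : Euc d₁ → Euc d₂ → ℝ) (x : Euc d₁) (τ : ℝ)
    (y₀ : Euc d₂) : ℕ → Euc d₂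
  | 0 => y₀
  | k + 1 =>
    gradientAscent f x τ y₀ k + τ • gradY f x (gradientAscent f x τ y₀ k)

/-- Stochastic gradient ascent in `y` at fixed `x`, with step size `τ`, from `y₀`, along the
sample sequence `ξ`. One iteration evaluates one stochastic gradient. -/
def stochGradientAscent {d₁ d₂ : ℕ} {Ξ : Type*} (Gy : Euc d₁ → Euc d₂ → Ξ → Euc d₂)
    (x : Euc d₁) (τ : ℝ) (y₀ : Euc d₂) (ξ : ℕ → Ξ) : ℕ → Euc d₂
  | 0 => y₀
  | k + 1 =>
    stochGradientAscent Gy x τ y₀ ξ k + τ • Gy x (stochGradientAscent Gy x τ y₀ ξ k) (ξ k)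

/-- One step of stochastic alternating gradient descent ascent, the dual variable first:
`y⁺ = y + τ₂ Gy(x, y, ξ₁)`, then `x⁺ = x - τ₁ Gx(x, y⁺, ξ₂)`. -/
def stochAGDAStep {d₁ d₂ : ℕ} {Ξ : Type*} (Gx : Euc d₁ → Euc d₂ → Ξ → Euc d₁)
    (Gy : Euc d₁ → Euc d₂ → Ξ → Euc d₂) (τ₁ τ₂ : ℝ) (ξ₁ ξ₂ : Ξ)
    (p : Euc d₁ × Euc d₂) : Euc d₁ × Euc d₂ :=
  (p.1 - τ₁ • Gx p.1 (p.2 + τ₂ • Gy p.1 p.2 ξ₁) ξ₂, p.2 + τ₂ • Gy p.1 p.2 ξ₁)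

/-- Stochastic AGDA from `(x₀, y₀)`; iteration `k` uses the samples `ξ (k, 0)` and `ξ (k, 1)`.
One iteration evaluates two stochastic gradients. -/
def stochAGDA {d₁ d₂ : ℕ} {Ξ : Type*} (Gx : Euc d₁ → Euc d₂ → Ξ → Euc d₁)
    (Gy : Euc d₁ → Euc d₂ → Ξ → Euc d₂) (τ₁ τ₂ : ℝ) (x₀ : Euc d₁) (y₀ : Euc d₂)
    (ξ : ℕ × Fin 2 → Ξ) : ℕ → Euc d₁ × Euc d₂
  | 0 => (x₀, y₀)
  | k + 1 =>
    stochAGDAStep Gx Gy τ₁ τ₂ (ξ (k, 0)) (ξ (k, 1)) (stochAGDA Gx Gy τ₁ τ₂ x₀ y₀ ξ k)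

/-- One step of alternating gradient descent ascent on `f`, the dual variable first. -/
def agdaStep {d₁ d₂ : ℕ} (f : Euc d₁ → Euc d₂ → ℝ) (τ₁ τ₂ : ℝ)
    (p : Euc d₁ × Euc d₂) : Euc d₁ × Euc d₂ :=
  (p.1 - τ₁ • gradX f p.1 (p.2 + τ₂ • gradY f p.1 p.2), p.2 + τ₂ • gradY f p.1 p.2)

/-- AGDA on `f` from `(x₀, y₀)`. One iteration evaluates two gradients. -/
def agda {d₁ d₂ : ℕ} (f : Euc d₁ → Euc d₂ → ℝ) (τ₁ τ₂ : ℝ) (x₀ : Euc d₁) (y₀ : Euc d₂) :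
    ℕ → Euc d₁ × Euc d₂
  | 0 => (x₀, y₀)
  | k + 1 => agdaStep f τ₁ τ₂ (agda f τ₁ τ₂ x₀ y₀ k)

/-- The auxiliary objective `f(x, y) + l‖x - z‖²`. -/
def regularized {d₁ d₂ : ℕ} (f : Euc d₁ → Euc d₂ → ℝ) (l : ℝ) (z : Euc d₁)
    (x : Euc d₁) (y : Euc d₂) : ℝ :=
  f x y + l * ‖x - z‖ ^ 2

/-- The stochastic `x`-gradient of `f(x, y) + l‖x - z‖²` that comes from `Gx`. -/
def regularizedGx {d₁ d₂ : ℕ} {Ξ : Type*} (Gx : Euc d₁ → Euc d₂ → Ξ → Euc d₁) (l : ℝ)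
    (z : Euc d₁) (x : Euc d₁) (y : Euc d₂) (ξ : Ξ) : Euc d₁ :=
  Gx x y ξ + (2 * l) • (x - z)

end

/-! Each algorithm contracts a nonnegative potential that is bounded, after one step, by a quadratic
in the sampling noise.

Structure of Φ. At a maximizer y₀ of f(x, ·) the y-gradient vanishes, so at x' it is at most l‖x' -
x‖, and the PL inequality puts Φ(x') at most l²/(2μ)‖x' - x‖² above f(x', y₀). This squeeze gives
Danskin's formula (`hasGradientAt_primal`). PL also implies quadratic growth
(`exists_maximizer_near`), which makes ∇Φ Lipschitz with a constant of order l(1 + κ).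

(a) The gap Φ(x) - f(x, y) contracts by 1 - μτ per step (`exists_ascent_step_le`). It starts below
ε'²/(2μ), and together with ‖∇Φ(x)‖ it controls both partial gradients of f.

(b) Put z = x̃, Φ̂ = Φ + l‖· - z‖² and ψ(y) = min_x f̂(x, y). The potential is V = (min Φ̂ - ψ(y)) +
(f̂(x, y) - ψ(y))/4. The function ψ inherits a PL inequality with the same μ (`psi_pl`), and f̂ is
strongly convex in x. A dual half-step decreases the first gap and may raise the second; a primal
half-step with τ₁ = 6τ₂ makes up for this, and V contracts by 1 - μτ₂ (`exists_dual_step_le`,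
`exists_primal_step_le`). Stationarity of the start gives V = O(ε²/l) and puts the minimizer x* of
Φ̂ within O(ε/l) of z, so that ‖∇Φ(x*)‖ = 2l‖x* - z‖ = O(ε). Since V bounds l‖x - x*‖² up to a
constant, it remains to shrink V by the factor κ², which takes of the order of κ log⁺ κ steps.

Noise. Each sample is independent of the state it acts on (`lintegral_fresh_le`), so the linear
noise term averages out and the quadratic one leaves a stationary error of order κτσ²; τ is lowered
until this is harmless. The deterministic claims are the stochastic ones on a one-point sample space
with σ = 0. If l < μ, the y-gradient vanishes identically and μ may be replaced by l. -/

noncomputable section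

/-! ### Quadratic bounds for smooth functions -/

section Smooth

variable {E : Type*} [NormedAddCommGroup E] [InnerProductSpace ℝ E]

/-- The quadratic upper bound for a function with Lipschitz gradient. -/
theorem le_quadratic_of_lipschitz_gradient [CompleteSpace E] {h : E → ℝ} {g : E → E} {l : ℝ}
    (hg : ∀ x, HasGradientAt h (g x) x) (hl : ∀ x y, ‖g x - g y‖ ≤ l * ‖x - y‖) (a b : E) :
    h b ≤ h a + inner ℝ (g a) (b - a) + l / 2 * ‖b - a‖ ^ 2 := by
  -- φ is the defect of the bound along the segment. Cauchy-Schwarz and the Lipschitz condition make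
  -- φ' ≤ 0 on (0, 1), and φ(1) ≤ φ(0) is the claim; no integration is needed.
  set φ : ℝ → ℝ := fun t =>
    h (a + t • (b - a)) - t * inner ℝ (g a) (b - a) - l / 2 * t ^ 2 * ‖b - a‖ ^ 2 with hφ
  have hd : ∀ t, HasDerivAt φ (inner ℝ (g (a + t • (b - a))) (b - a)
      - inner ℝ (g a) (b - a) - l * t * ‖b - a‖ ^ 2) t := by
    intro t
    have h1 : HasDerivAt (fun t : ℝ => a + t • (b - a)) (b - a) t := by
      simpa using ((hasDerivAt_id t).smul_const (b - a)).const_add a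
    have h2 := (hasGradientAt_iff_hasFDerivAt.mp (hg (a + t • (b - a)))).comp_hasDerivAt t h1
    have h3 : HasDerivAt (fun t : ℝ => t * inner ℝ (g a) (b - a)) (inner ℝ (g a) (b - a)) t := by
      simpa using (hasDerivAt_id t).mul_const (inner ℝ (g a) (b - a))
    have h4 : HasDerivAt (fun t : ℝ => l / 2 * t ^ 2 * ‖b - a‖ ^ 2) (l * t * ‖b - a‖ ^ 2) t := by
      have := (((hasDerivAt_id t).pow 2).const_mul (l / 2)).mul_const (‖b - a‖ ^ 2)
      refine this.congr_deriv ?_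
      change l / 2 * (((2 : ℕ) : ℝ) * t ^ 1 * 1) * ‖b - a‖ ^ 2 = _
      push_cast; ring
    rw [InnerProductSpace.toDual_apply_apply] at h2
    exact (h2.sub h3).sub h4
  have hanti : AntitoneOn φ (Set.Icc 0 1) := by
    refine antitoneOn_of_deriv_nonpos (convex_Icc 0 1)
      (fun t _ => (hd t).continuousAt.continuousWithinAt)
      (fun t _ => (hd t).differentiableAt.differentiableWithinAt) fun t ht => ?_
    rw [interior_Icc] at ht
    rw [(hd t).deriv]
    have h1 := hl (a + t • (b - a)) a
    rw [add_sub_cancel_left, norm_smul, Real.norm_of_nonneg ht.1.le] at h1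
    have h2 := real_inner_le_norm (g (a + t • (b - a)) - g a) (b - a)
    rw [inner_sub_left] at h2
    nlinarith [mul_le_mul_of_nonneg_right h1 (norm_nonneg (b - a))]
  have := hanti (Set.left_mem_Icc.mpr zero_le_one) (Set.right_mem_Icc.mpr zero_le_one) zero_le_one
  simp only [hφ, zero_smul, one_smul, add_zero, add_sub_cancel] at this
  norm_num at this
  linarith

/-- The quadratic lower bound for a function with Lipschitz gradient. -/
theorem quadratic_le_of_lipschitz_gradient [CompleteSpace E] {h : E → ℝ} {g : E → E} {l : ℝ}
    (hg : ∀ x, HasGradientAt h (g x) x) (hl : ∀ x y, ‖g x - g y‖ ≤ l * ‖x - y‖) (a b : E) :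
    h a + inner ℝ (g a) (b - a) - l / 2 * ‖b - a‖ ^ 2 ≤ h b := by
  have := le_quadratic_of_lipschitz_gradient (h := fun x => - h x) (g := fun x => - g x) (l := l)
    (fun x => by
      have := hasGradientAt_iff_hasFDerivAt.mp (hg x)
      rw [hasGradientAt_iff_hasFDerivAt, map_neg]
      exact this.neg)
    (fun x y => by
      rw [show -g x - -g y = -(g x - g y) by abel, norm_neg]
      exact hl x y) a b
  simp only [inner_neg_left] at this
  linarith

/-- A quadratic error is o(‖y - x‖). This turns two-sided squeezes into derivatives, both for Φ and
for the regularized objective. -/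
theorem hasGradientAt_of_quadratic_bound [CompleteSpace E] {h : E → ℝ} {v x : E} {c : ℝ}
    (H : ∀ y, |h y - h x - inner ℝ v (y - x)| ≤ c * ‖y - x‖ ^ 2) : HasGradientAt h v x := by
  rw [hasGradientAt_iff_isLittleO]
  have h1 : (fun y => h y - h x - inner ℝ v (y - x)) =O[nhds x] fun y => ‖y - x‖ ^ 2 := by
    refine Asymptotics.IsBigO.of_bound c (Filter.Eventually.of_forall fun y => ?_)
    simpa using H y
  refine h1.trans_isLittleO ?_
  have h2 : (fun y : E => ‖y - x‖ ^ 2) =o[nhds (0 + x)] fun y => ‖y - x‖ ^ 1 := by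
    have h3 := (Asymptotics.isLittleO_norm_pow_norm_pow (E' := E) (m := 1) (n := 2) (by norm_num))
    have h4 : Filter.Tendsto (fun y => y - x) (nhds (0 + x)) (nhds 0) := by
      have : Continuous fun y : E => y - x := by fun_prop
      simpa using this.tendsto x
    rw [zero_add]
    rw [zero_add] at h4
    exact h3.comp_tendsto h4
  rw [zero_add] at h2
  simpa using h2

/-- The first-order condition at a global minimum, from a quadratic upper bound. -/
theorem eq_zero_of_isMin_of_le_quadratic {h : E → ℝ} {v x : E} {c : ℝ} (hc : 0 < c)
    (hmin : ∀ y, h x ≤ h y) (H : ∀ y, h y ≤ h x + inner ℝ v (y - x) + c * ‖y - x‖ ^ 2) :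
    v = 0 := by
  -- The test point minimises the quadratic upper bound; its value there is h x - ‖v‖²/(4c).
  have h1 := H (x - (1 / (2 * c)) • v)
  have h2 := hmin (x - (1 / (2 * c)) • v)
  rw [show x - (1 / (2 * c)) • v - x = -((1 / (2 * c)) • v) by abel, norm_neg, norm_smul,
    inner_neg_right, inner_smul_right, real_inner_self_eq_norm_sq, mul_pow, Real.norm_eq_abs,
    sq_abs] at h1
  have h3 : c * ((1 / (2 * c)) ^ 2 * ‖v‖ ^ 2) = 1 / (4 * c) * ‖v‖ ^ 2 := by field_simp; ring
  have h4 : 1 / (2 * c) * ‖v‖ ^ 2 = 2 * (1 / (4 * c) * ‖v‖ ^ 2) := by field_simp; ring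
  have h5 : 1 / (4 * c) * ‖v‖ ^ 2 ≤ 0 := by linarith
  have h6 : 0 < 1 / (4 * c) := by positivity
  have h7 : ‖v‖ ^ 2 ≤ 0 := by
    by_contra! hv
    exact absurd (mul_pos h6 hv) (not_lt.mpr h5)
  exact norm_eq_zero.mp (pow_eq_zero_iff (two_ne_zero) |>.mp (le_antisymm h7 (sq_nonneg _)))

/-- Outside the ball of radius ‖v‖/c around x₀ the quadratic term beats the linear one, so h ≥ h x₀
there and compactness applies. -/
theorem exists_isMin_of_quadratic_le [FiniteDimensional ℝ E] {h : E → ℝ} {v x₀ : E} {c : ℝ}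
    (hc : 0 < c) (hcont : Continuous h)
    (H : ∀ x, h x₀ + inner ℝ v (x - x₀) + c * ‖x - x₀‖ ^ 2 ≤ h x) : ∃ x, ∀ y, h x ≤ h y := by
  have : ProperSpace E := FiniteDimensional.proper ℝ E
  refine hcont.exists_forall_le' x₀ ?_
  filter_upwards [(tendsto_dist_right_cocompact_atTop x₀).eventually_ge_atTop (‖v‖ / c)] with x hx
  rw [dist_eq_norm, div_le_iff₀ hc] at hx
  have h1 := neg_le_of_abs_le (abs_real_inner_le_norm v (x - x₀))
  nlinarith [H x, norm_nonneg (x - x₀)]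

/-- Completing the square. -/
theorem neg_sq_div_le_inner_add {c : ℝ} (hc : 0 < c) (v w : E) :
    -(‖v‖ ^ 2 / (2 * c)) ≤ inner ℝ v w + c / 2 * ‖w‖ ^ 2 := by
  have h1 := neg_le_of_abs_le (abs_real_inner_le_norm v w)
  have h2 : ‖v‖ ^ 2 / (2 * c) - ‖v‖ * ‖w‖ + c / 2 * ‖w‖ ^ 2
      = (‖v‖ - c * ‖w‖) ^ 2 / (2 * c) := by field_simp; ring
  have h3 : 0 ≤ (‖v‖ - c * ‖w‖) ^ 2 / (2 * c) := by positivity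
  linarith

theorem norm_sub_sq_le_two_mul (a b : E) : ‖a - b‖ ^ 2 ≤ 2 * ‖a‖ ^ 2 + 2 * ‖b‖ ^ 2 := by
  nlinarith [parallelogram_law_with_norm ℝ a b, sq_nonneg ‖a + b‖, sq_nonneg ‖a - b‖]

theorem norm_add_sq_le_two_mul (a b : E) : ‖a + b‖ ^ 2 ≤ 2 * ‖a‖ ^ 2 + 2 * ‖b‖ ^ 2 := by
  nlinarith [parallelogram_law_with_norm ℝ a b, sq_nonneg ‖a + b‖, sq_nonneg ‖a - b‖]

end Smooth

variable {d₁ d₂ : ℕ} {f : Euc d₁ → Euc d₂ → ℝ} {l μ : ℝ}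

/-! ### Continuity and quadratic bounds for f in each variable -/

namespace LipschitzSmooth

theorem hasGradientAt_gradX (hf : LipschitzSmooth f l) (x : Euc d₁) (y : Euc d₂) :
    HasGradientAt (fun x' => f x' y) (gradX f x y) x := by
  refine DifferentiableAt.hasGradientAt ?_
  exact (hf.differentiable (x, y)).comp (g := fun p : Euc d₁ × Euc d₂ => f p.1 p.2) x
    (f := fun x' => (x', y)) (by fun_prop)

theorem hasGradientAt_gradY (hf : LipschitzSmooth f l) (x : Euc d₁) (y : Euc d₂) :
    HasGradientAt (fun y' => f x y') (gradY f x y) y := by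
  refine DifferentiableAt.hasGradientAt ?_
  exact (hf.differentiable (x, y)).comp (g := fun p : Euc d₁ × Euc d₂ => f p.1 p.2) y
    (f := fun y' => (x, y')) (by fun_prop)

theorem continuous_uncurry (hf : LipschitzSmooth f l) :
    Continuous (fun p : Euc d₁ × Euc d₂ => f p.1 p.2) := hf.differentiable.continuous

theorem continuous_gradX (hf : LipschitzSmooth f l) :
    Continuous (fun p : Euc d₁ × Euc d₂ => gradX f p.1 p.2) := by
  refine continuous_iff_continuousAt.mpr fun p => ?_
  rw [ContinuousAt, tendsto_iff_norm_sub_tendsto_zero]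
  refine squeeze_zero (fun _ => norm_nonneg _) (fun q => hf.lipschitz_gradX q.1 p.1 q.2 p.2) ?_
  have : Continuous fun q : Euc d₁ × Euc d₂ => l * (‖q.1 - p.1‖ + ‖q.2 - p.2‖) := by fun_prop
  simpa using this.tendsto p

theorem continuous_gradY (hf : LipschitzSmooth f l) :
    Continuous (fun p : Euc d₁ × Euc d₂ => gradY f p.1 p.2) := by
  refine continuous_iff_continuousAt.mpr fun p => ?_
  rw [ContinuousAt, tendsto_iff_norm_sub_tendsto_zero]
  refine squeeze_zero (fun _ => norm_nonneg _) (fun q => hf.lipschitz_gradY q.1 p.1 q.2 p.2) ?_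
  have : Continuous fun q : Euc d₁ × Euc d₂ => l * (‖q.1 - p.1‖ + ‖q.2 - p.2‖) := by fun_prop
  simpa using this.tendsto p

theorem le_quadratic_x (hf : LipschitzSmooth f l) (x x' : Euc d₁) (y : Euc d₂) :
    f x' y ≤ f x y + inner ℝ (gradX f x y) (x' - x) + l / 2 * ‖x' - x‖ ^ 2 :=
  le_quadratic_of_lipschitz_gradient (fun x => hf.hasGradientAt_gradX x y)
    (fun a b => by simpa using hf.lipschitz_gradX a b y y) x x'

theorem quadratic_le_x (hf : LipschitzSmooth f l) (x x' : Euc d₁) (y : Euc d₂) :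
    f x y + inner ℝ (gradX f x y) (x' - x) - l / 2 * ‖x' - x‖ ^ 2 ≤ f x' y :=
  quadratic_le_of_lipschitz_gradient (fun x => hf.hasGradientAt_gradX x y)
    (fun a b => by simpa using hf.lipschitz_gradX a b y y) x x'

theorem le_quadratic_y (hf : LipschitzSmooth f l) (x : Euc d₁) (y y' : Euc d₂) :
    f x y' ≤ f x y + inner ℝ (gradY f x y) (y' - y) + l / 2 * ‖y' - y‖ ^ 2 :=
  le_quadratic_of_lipschitz_gradient (fun y => hf.hasGradientAt_gradY x y)
    (fun a b => by simpa using hf.lipschitz_gradY x x a b) y y'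

theorem quadratic_le_y (hf : LipschitzSmooth f l) (x : Euc d₁) (y y' : Euc d₂) :
    f x y + inner ℝ (gradY f x y) (y' - y) - l / 2 * ‖y' - y‖ ^ 2 ≤ f x y' :=
  quadratic_le_of_lipschitz_gradient (fun y => hf.hasGradientAt_gradY x y)
    (fun a b => by simpa using hf.lipschitz_gradY x x a b) y y'

end LipschitzSmooth

/-! ### The primal function under the PL condition -/

namespace PLCondition

theorem le_primal (hp : PLCondition f μ) (x : Euc d₁) (y : Euc d₂) : f x y ≤ primal f x := by
  obtain ⟨y₀, h⟩ := hp.exists_max x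
  exact le_ciSup (f := fun y => f x y) ⟨f x y₀, by rintro _ ⟨y, rfl⟩; exact h y⟩ y

theorem exists_eq_primal (hp : PLCondition f μ) (x : Euc d₁) : ∃ y, f x y = primal f x := by
  obtain ⟨y₀, h⟩ := hp.exists_max x
  exact ⟨y₀, le_antisymm (hp.le_primal x y₀) (ciSup_le h)⟩

theorem mono {μ' : ℝ} (hp : PLCondition f μ) (h0 : 0 < μ') (h : μ' ≤ μ) : PLCondition f μ' where
  pos := h0
  exists_max := hp.exists_max
  pl x y := by
    have h1 := hp.pl x y
    have h2 := hp.le_primal x y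
    nlinarith

/-- The primal gap at a perturbed point is quadratic in the perturbation. -/
theorem primal_le_of_maximizer (hf : LipschitzSmooth f l) (hp : PLCondition f μ) {x : Euc d₁}
    {y₀ : Euc d₂} (h0 : f x y₀ = primal f x) (x' : Euc d₁) :
    primal f x' ≤ f x' y₀ + l ^ 2 / (2 * μ) * ‖x' - x‖ ^ 2 := by
  have hμ := hp.pos
  have hg : gradY f x y₀ = 0 := by
    refine neg_eq_zero.mp (eq_zero_of_isMin_of_le_quadratic (h := fun y => - f x y) (x := y₀)
      (half_pos hf.pos) (fun y => ?_) fun y => ?_)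
    · have := hp.le_primal x y
      simp only [h0]; linarith
    · have := hf.quadratic_le_y x y₀ y
      rw [inner_neg_left]; linarith
  -- Since the y-gradient vanishes at (x, y₀), it has size at most l‖x' - x‖ at (x', y₀); PL at x'
  -- turns this into a bound on the gap.
  have h1 := hf.lipschitz_gradY x' x y₀ y₀
  rw [hg, sub_zero, sub_self, norm_zero, add_zero] at h1
  have h2 := hp.pl x' y₀
  have h3 : ‖gradY f x' y₀‖ ^ 2 ≤ l ^ 2 * ‖x' - x‖ ^ 2 := by
    rw [← mul_pow]; exact pow_le_pow_left₀ (norm_nonneg _) h1 2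
  have h4 : primal f x' - f x' y₀ ≤ l ^ 2 * ‖x' - x‖ ^ 2 / (2 * μ) := by
    rw [le_div_iff₀ (by positivity)]; linarith
  have h5 : l ^ 2 / (2 * μ) * ‖x' - x‖ ^ 2 = l ^ 2 * ‖x' - x‖ ^ 2 / (2 * μ) := by ring
  linarith

theorem primal_le_quadratic (hf : LipschitzSmooth f l) (hp : PLCondition f μ) {x : Euc d₁}
    {y₀ : Euc d₂} (h0 : f x y₀ = primal f x) (x' : Euc d₁) :
    primal f x' ≤ primal f x + inner ℝ (gradX f x y₀) (x' - x)
      + (l / 2 + l ^ 2 / (2 * μ)) * ‖x' - x‖ ^ 2 := by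
  have h1 := primal_le_of_maximizer hf hp h0 x'
  have h2 := hf.le_quadratic_x x x' y₀
  rw [add_mul]; linarith

/-- Danskin's formula under the Polyak-Łojasiewicz condition. -/
theorem hasGradientAt_primal (hf : LipschitzSmooth f l) (hp : PLCondition f μ) {x : Euc d₁}
    {y₀ : Euc d₂} (h0 : f x y₀ = primal f x) :
    HasGradientAt (primal f) (gradX f x y₀) x := by
  have hμ := hp.pos
  refine hasGradientAt_of_quadratic_bound (c := l / 2 + l ^ 2 / (2 * μ)) fun x' => ?_
  have h1 := primal_le_quadratic hf hp h0 x'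
  have h2 := hf.quadratic_le_x x x' y₀
  have h3 := hp.le_primal x' y₀
  have h4 : 0 ≤ l ^ 2 / (2 * μ) * ‖x' - x‖ ^ 2 := by positivity
  rw [add_mul] at h1 ⊢
  rw [abs_le]; constructor <;> linarith

theorem differentiable_primal (hf : LipschitzSmooth f l) (hp : PLCondition f μ) :
    Differentiable ℝ (primal f) := fun x => by
  obtain ⟨y₀, h0⟩ := hp.exists_eq_primal x
  exact (hasGradientAt_primal hf hp h0).differentiableAt

theorem gradient_primal (hf : LipschitzSmooth f l) (hp : PLCondition f μ) {x : Euc d₁}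
    {y₀ : Euc d₂} (h0 : f x y₀ = primal f x) : gradient (primal f) x = gradX f x y₀ :=
  (hasGradientAt_primal hf hp h0).gradient

/-- An ascent step of length 1/l gains at least ‖∇_y f‖²/(2l) and cannot exceed the maximum. -/
theorem norm_gradY_sq_le (hf : LipschitzSmooth f l) (hp : PLCondition f μ) (x : Euc d₁)
    (y : Euc d₂) : ‖gradY f x y‖ ^ 2 ≤ 2 * l * (primal f x - f x y) := by
  have hl := hf.pos
  have h1 := hf.quadratic_le_y x y (y + (1 / l) • gradY f x y)
  have h2 := hp.le_primal x (y + (1 / l) • gradY f x y)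
  rw [add_sub_cancel_left, norm_smul, inner_smul_right, real_inner_self_eq_norm_sq, mul_pow,
    Real.norm_eq_abs, sq_abs] at h1
  have h3 : l / 2 * ((1 / l) ^ 2 * ‖gradY f x y‖ ^ 2) = ‖gradY f x y‖ ^ 2 / (2 * l) := by
    field_simp
  have h4 : 1 / l * ‖gradY f x y‖ ^ 2 = 2 * (‖gradY f x y‖ ^ 2 / (2 * l)) := by field_simp
  have h5 : ‖gradY f x y‖ ^ 2 / (2 * l) ≤ primal f x - f x y := by linarith
  rw [div_le_iff₀ (by positivity)] at h5
  linarith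

/-- The two bounds 2μ·gap ≤ ‖∇_y f‖² ≤ 2l·gap are incompatible with a positive gap when l < μ. -/
theorem gradY_eq_zero_of_lt (hf : LipschitzSmooth f l) (hp : PLCondition f μ) (h : l < μ)
    (x : Euc d₁) (y : Euc d₂) : gradY f x y = 0 := by
  have h1 := norm_gradY_sq_le hf hp x y
  have h2 := hp.pl x y
  have h3 := hp.le_primal x y
  have h4 : primal f x - f x y ≤ 0 := by nlinarith
  have h5 : primal f x - f x y = 0 := by linarith
  rw [h5, mul_zero] at h1
  exact norm_eq_zero.mp (pow_eq_zero_iff two_ne_zero |>.mp (le_antisymm h1 (sq_nonneg _)))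

/-- The Polyak-Łojasiewicz inequality implies quadratic growth. -/
theorem exists_maximizer_near (hf : LipschitzSmooth f l) (hp : PLCondition f μ) (x : Euc d₁)
    (y : Euc d₂) :
    ∃ y₀, f x y₀ = primal f x ∧ μ * ‖y - y₀‖ ^ 2 ≤ 9 * (primal f x - f x y) := by
  have hl := hf.pos
  have hμ := hp.pos
  set s : Euc d₂ → ℝ := fun z => Real.sqrt (primal f x - f x z) with hs
  -- PL gives α s(z) ≤ N/(3√2) for the gradient norm N at z. The contradiction below needs α s(z) <
  -- N/4, which holds because 3√2 > 4; the factor 9 in the conclusion is μ/α².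
  set α : ℝ := Real.sqrt μ / 3 with hα
  have hα0 : 0 < α := by positivity
  have hα2 : α ^ 2 = μ / 9 := by rw [hα, div_pow, Real.sq_sqrt hμ.le]; norm_num
  have hcont : Continuous fun z => s z + α * ‖z - y‖ := by
    have : Continuous fun z => f x z :=
      hf.continuous_uncurry.comp (continuous_const.prodMk continuous_id)
    fun_prop
  -- An Ekeland-type argument in place of gradient flow: minimise s + α‖· - y‖. Once s(z) = 0 is
  -- known, comparison with y gives α‖z - y‖ ≤ s(y).
  obtain ⟨z, hz⟩ := hcont.exists_forall_le' y (by
    filter_upwards [(tendsto_dist_right_cocompact_atTop y).eventually_ge_atTop (s y / α)] with w hw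
    rw [dist_eq_norm, div_le_iff₀ hα0] at hw
    have : 0 ≤ s w := Real.sqrt_nonneg _
    rw [sub_self, norm_zero, mul_zero, add_zero]
    linarith)
  have hsq : ∀ w, s w ^ 2 = primal f x - f x w := fun w =>
    Real.sq_sqrt (by have := hp.le_primal x w; linarith)
  have hs0 : ∀ w, 0 ≤ s w := fun w => Real.sqrt_nonneg _
  have hzero : s z = 0 := by
    by_contra hne
    have hpos : 0 < s z := lt_of_le_of_ne (hs0 z) (Ne.symm hne)
    set N := ‖gradY f x z‖ with hN
    have hN2 : 2 * μ * s z ^ 2 ≤ N ^ 2 := by rw [hsq]; exact hp.pl x z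
    have hN0 : 0 ≤ N := norm_nonneg _
    have hNpos : 0 < N := by
      rcases hN0.eq_or_lt with h | h
      · rw [← h] at hN2
        have : 0 < 2 * μ * s z ^ 2 := by positivity
        norm_num at hN2; linarith
      · exact h
    -- If s(z) > 0, an ascent step lowers s² by at least N²/(2l), whereas minimality of z only
    -- allows a decrease of 2α s(z) N/l, which is smaller.
    set w := z + (1 / l) • gradY f x z with hw
    have h1 := hf.quadratic_le_y x z w
    rw [hw, add_sub_cancel_left, norm_smul, inner_smul_right, real_inner_self_eq_norm_sq, mul_pow,
      Real.norm_eq_abs, sq_abs, ← hw, ← hN] at h1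
    have h3 : l / 2 * ((1 / l) ^ 2 * N ^ 2) = N ^ 2 / (2 * l) := by field_simp
    have h4 : 1 / l * N ^ 2 = 2 * (N ^ 2 / (2 * l)) := by field_simp
    have h5 : s w ^ 2 ≤ s z ^ 2 - N ^ 2 / (2 * l) := by rw [hsq, hsq]; linarith
    have h6 : s z ≤ s w + α * (N / l) := by
      have h7 := hz w
      have h8 : ‖w - y‖ ≤ ‖z - y‖ + N / l := by
        have h9 : w - y = (z - y) + (1 / l) • gradY f x z := by rw [hw]; abel
        rw [h9]
        refine (norm_add_le _ _).trans ?_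
        rw [norm_smul, Real.norm_of_nonneg (by positivity : (0:ℝ) ≤ 1 / l)]
        rw [← hN, div_mul_eq_mul_div, one_mul]
      have := mul_le_mul_of_nonneg_left h8 hα0.le
      linarith
    have h10 : α * s z < N / 4 := by
      refine lt_of_pow_lt_pow_left₀ 2 (by positivity) ?_
      rw [mul_pow, hα2, div_pow]
      have : 0 < μ * s z ^ 2 := by positivity
      nlinarith
    have h11 : N ^ 2 / (2 * l) = N / l * (N / 2) := by field_simp
    have h12 : 0 < N / l := by positivity
    have h13 : s w ≤ s z := by
      refine le_of_sq_le_sq ?_ (hs0 z)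
      have : 0 ≤ N ^ 2 / (2 * l) := by positivity
      linarith
    have h14 : s z ^ 2 - s w ^ 2 ≤ α * (N / l) * (2 * s z) := by
      have : s z ^ 2 - s w ^ 2 = (s z - s w) * (s z + s w) := by ring
      rw [this]
      refine mul_le_mul (by linarith) (by linarith) (by linarith [hs0 w, hs0 z]) (by positivity)
    nlinarith
  refine ⟨z, ?_, ?_⟩
  · have := hsq z
    rw [hzero] at this; norm_num at this; linarith
  · have h1 := hz y
    rw [hzero, sub_self, norm_zero, mul_zero, add_zero, zero_add, norm_sub_rev] at h1
    have h2 := pow_le_pow_left₀ (by positivity) h1 2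
    rw [mul_pow, hα2, hsq] at h2
    linarith

/-- The gradient of the primal function is Lipschitz. -/
theorem lipschitz_gradient_primal (hf : LipschitzSmooth f l) (hp : PLCondition f μ)
    (x x' : Euc d₁) :
    ‖gradient (primal f) x' - gradient (primal f) x‖ ≤ l * (1 + 3 * (l / μ)) * ‖x' - x‖ := by
  have hl := hf.pos
  have hμ := hp.pos
  obtain ⟨y, hy⟩ := hp.exists_eq_primal x
  -- Maximizers need not be unique, so the one at x' is chosen close to y. The gap of y at x' is at
  -- most l²/(2μ)‖x' - x‖², and quadratic growth gives ‖y' - y‖ ≤ 3κ‖x' - x‖.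
  obtain ⟨y', hy', hd⟩ := exists_maximizer_near hf hp x' y
  rw [gradient_primal hf hp hy, gradient_primal hf hp hy']
  have h1 := primal_le_of_maximizer hf hp hy x'
  have h2 : ‖y' - y‖ ≤ 3 * (l / μ) * ‖x' - x‖ := by
    rw [norm_sub_rev]
    refine le_of_sq_le_sq ?_ (by positivity)
    have h3 : μ * ‖y - y'‖ ^ 2 ≤ μ * (9 / 2 * (l / μ) ^ 2 * ‖x' - x‖ ^ 2) := by
      have : μ * (9 / 2 * (l / μ) ^ 2 * ‖x' - x‖ ^ 2)
        = 9 * (l ^ 2 / (2 * μ) * ‖x' - x‖ ^ 2) := by field_simp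
      rw [this]; linarith
    have h4 := le_of_mul_le_mul_left h3 hμ
    have h5 : 0 ≤ (l / μ) ^ 2 * ‖x' - x‖ ^ 2 := by positivity
    nlinarith
  have h3 := hf.lipschitz_gradX x' x y' y
  have h4 := mul_le_mul_of_nonneg_left h2 hl.le
  nlinarith

end PLCondition
end

/-! ### The regularized objective and its minimizers in x -/

noncomputable section

variable {d₁ d₂ : ℕ} {f : Euc d₁ → Euc d₂ → ℝ} {l μ : ℝ}

/-- The partial gradient in `x` of `regularized f l z`. -/
def regularizedGradX (f : Euc d₁ → Euc d₂ → ℝ) (l : ℝ) (z : Euc d₁) (x : Euc d₁) (y : Euc d₂) :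
    Euc d₁ :=
  gradX f x y + (2 * l) • (x - z)

theorem norm_sub_sq_expand {E : Type*} [NormedAddCommGroup E] [InnerProductSpace ℝ E]
    (x x' z : E) :
    ‖x' - z‖ ^ 2 = ‖x - z‖ ^ 2 + 2 * inner ℝ (x - z) (x' - x) + ‖x' - x‖ ^ 2 := by
  rw [show x' - z = (x - z) + (x' - x) by abel, norm_add_sq_real]

namespace LipschitzSmooth

/-- The added term has curvature 2l, which outweighs the possible concavity -l of f(·, y) and leaves
strong convexity with constant l. -/
theorem quadratic_le_regularized (hf : LipschitzSmooth f l) (z x x' : Euc d₁) (y : Euc d₂) :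
    regularized f l z x y + inner ℝ (regularizedGradX f l z x y) (x' - x) + l / 2 * ‖x' - x‖ ^ 2
      ≤ regularized f l z x' y := by
  have h := hf.quadratic_le_x x x' y
  rw [regularized, regularized, norm_sub_sq_expand x x' z, regularizedGradX, inner_add_left,
    real_inner_smul_left]
  linarith

theorem regularized_le_quadratic (hf : LipschitzSmooth f l) (z x x' : Euc d₁) (y : Euc d₂) :
    regularized f l z x' y ≤ regularized f l z x y
      + inner ℝ (regularizedGradX f l z x y) (x' - x) + 3 * l / 2 * ‖x' - x‖ ^ 2 := by
  have h := hf.le_quadratic_x x x' y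
  rw [regularized, regularized, norm_sub_sq_expand x x' z, regularizedGradX, inner_add_left,
    real_inner_smul_left]
  linarith

theorem gradX_regularized (hf : LipschitzSmooth f l) (z x : Euc d₁) (y : Euc d₂) :
    gradX (regularized f l z) x y = regularizedGradX f l z x y := by
  refine HasGradientAt.gradient (hasGradientAt_of_quadratic_bound (c := 3 * l / 2) fun x' => ?_)
  have h1 := hf.quadratic_le_regularized z x x' y
  have h2 := hf.regularized_le_quadratic z x x' y
  have h3 : 0 ≤ l / 2 * ‖x' - x‖ ^ 2 := mul_nonneg (half_pos hf.pos).le (sq_nonneg _)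
  rw [abs_le]; constructor <;> linarith

theorem continuous_regularized (hf : LipschitzSmooth f l) (z : Euc d₁) :
    Continuous fun p : Euc d₁ × Euc d₂ => regularized f l z p.1 p.2 := by
  have := hf.continuous_uncurry
  unfold regularized
  fun_prop

theorem exists_argmin (hf : LipschitzSmooth f l) (z : Euc d₁) (y : Euc d₂) :
    ∃ x, ∀ x', regularized f l z x y ≤ regularized f l z x' y :=
  exists_isMin_of_quadratic_le (half_pos hf.pos)
    ((hf.continuous_regularized z).comp (Continuous.prodMk_left y))
    fun x' => hf.quadratic_le_regularized z 0 x' y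

end LipschitzSmooth

theorem gradY_regularized (f : Euc d₁ → Euc d₂ → ℝ) (l : ℝ) (z x : Euc d₁) (y : Euc d₂) :
    gradY (regularized f l z) x y = gradY f x y := by
  simp only [gradY, gradient, regularized, fderiv_add_const]

theorem PLCondition.exists_argmin_primal (hf : LipschitzSmooth f l) (hp : PLCondition f μ)
    (z : Euc d₁) :
    ∃ x, ∀ x', primal f x + l * ‖x - z‖ ^ 2 ≤ primal f x' + l * ‖x' - z‖ ^ 2 := by
  obtain ⟨y, hy⟩ := hp.exists_eq_primal 0
  have hc := (PLCondition.differentiable_primal hf hp).continuous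
  refine exists_isMin_of_quadratic_le (h := fun x => primal f x + l * ‖x - z‖ ^ 2)
    (v := regularizedGradX f l z 0 y) (x₀ := 0) (half_pos hf.pos) (by fun_prop) fun x' => ?_
  have h1 := hf.quadratic_le_regularized z 0 x' y
  have h2 := hp.le_primal x' y
  simp only [regularized] at h1
  rw [hy] at h1
  linarith

/-- `m y` minimises the regularized objective at `y`, and `xs` minimises its primal function. -/
structure IsRegularizedArgmin (f : Euc d₁ → Euc d₂ → ℝ) (l : ℝ) (z : Euc d₁)
    (m : Euc d₂ → Euc d₁) (xs : Euc d₁) : Prop where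
  argmin : ∀ y x, regularized f l z (m y) y ≤ regularized f l z x y
  argmin_primal : ∀ x, primal f xs + l * ‖xs - z‖ ^ 2 ≤ primal f x + l * ‖x - z‖ ^ 2

theorem exists_isRegularizedArgmin (hf : LipschitzSmooth f l) (hp : PLCondition f μ)
    (z : Euc d₁) : ∃ m xs, IsRegularizedArgmin f l z m xs := by
  choose m hm using hf.exists_argmin z
  obtain ⟨xs, hxs⟩ := hp.exists_argmin_primal hf z
  exact ⟨m, xs, hm, hxs⟩

/-- The gap in `y` plus `c` times the gap in `x`. -/
def lyapunov (f : Euc d₁ → Euc d₂ → ℝ) (l : ℝ) (z : Euc d₁) (m : Euc d₂ → Euc d₁) (xs : Euc d₁)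
    (c : ℝ) (x : Euc d₁) (y : Euc d₂) : ℝ :=
  (primal f xs + l * ‖xs - z‖ ^ 2 - regularized f l z (m y) y)
    + c * (regularized f l z x y - regularized f l z (m y) y)

/-! ### The AGDA potential: contraction, initial size and what it controls -/

namespace IsRegularizedArgmin

variable {z xs : Euc d₁} {m : Euc d₂ → Euc d₁}

theorem regularizedGradX_eq_zero (hm : IsRegularizedArgmin f l z m xs) (hf : LipschitzSmooth f l)
    (y : Euc d₂) : regularizedGradX f l z (m y) y = 0 :=
  eq_zero_of_isMin_of_le_quadratic (h := fun x => regularized f l z x y) (c := 3 * l / 2)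
    (by linarith [hf.pos]) (hm.argmin y) fun x => hf.regularized_le_quadratic z (m y) x y

theorem gap_le (_hm : IsRegularizedArgmin f l z m xs) (hf : LipschitzSmooth f l) (x : Euc d₁)
    (y : Euc d₂) :
    regularized f l z x y - regularized f l z (m y) y
      ≤ ‖regularizedGradX f l z x y‖ ^ 2 / (2 * l) := by
  have h1 := hf.quadratic_le_regularized z x (m y) y
  have h2 := neg_sq_div_le_inner_add hf.pos (regularizedGradX f l z x y) (m y - x)
  linarith

theorem growth (hm : IsRegularizedArgmin f l z m xs) (hf : LipschitzSmooth f l) (x : Euc d₁)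
    (y : Euc d₂) :
    l / 2 * ‖x - m y‖ ^ 2 ≤ regularized f l z x y - regularized f l z (m y) y := by
  have h1 := hf.quadratic_le_regularized z (m y) x y
  rw [hm.regularizedGradX_eq_zero hf, inner_zero_left] at h1
  linarith

/-- Strong convexity bounds ψ(y') below by f̂(m y, y') minus ‖∇ₓf̂(m y, y')‖²/(2l). That gradient
vanishes at y' = y, hence is at most l‖y' - y‖, and the loss is l/2‖y' - y‖²; smoothness in y loses
as much again. Neither differentiability of ψ nor regularity of `m` is needed. -/
theorem psi_lower (hm : IsRegularizedArgmin f l z m xs) (hf : LipschitzSmooth f l)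
    (y y' : Euc d₂) :
    regularized f l z (m y) y + inner ℝ (gradY f (m y) y) (y' - y) - l * ‖y' - y‖ ^ 2
      ≤ regularized f l z (m y') y' := by
  have hl := hf.pos
  have h1 := hm.gap_le hf (m y) y'
  have h2 := hf.quadratic_le_y (m y) y y'
  have h3 : ‖regularizedGradX f l z (m y) y'‖ ≤ l * ‖y' - y‖ := by
    have h4 := hf.lipschitz_gradX (m y) (m y) y' y
    rw [sub_self, norm_zero, zero_add] at h4
    rw [← sub_zero (regularizedGradX f l z (m y) y'), ← hm.regularizedGradX_eq_zero hf y,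
      regularizedGradX, regularizedGradX, add_sub_add_right_eq_sub]
    exact h4
  have h5 : ‖regularizedGradX f l z (m y) y'‖ ^ 2 / (2 * l) ≤ l / 2 * ‖y' - y‖ ^ 2 := by
    rw [div_le_iff₀ (by positivity)]
    have := pow_le_pow_left₀ (norm_nonneg _) h3 2
    nlinarith
  simp only [regularized] at h1 ⊢
  linarith

theorem psi_le (hm : IsRegularizedArgmin f l z m xs) (hp : PLCondition f μ) (y : Euc d₂) :
    regularized f l z (m y) y ≤ primal f xs + l * ‖xs - z‖ ^ 2 := by
  have h1 := hm.argmin y xs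
  have h2 := hp.le_primal xs y
  simp only [regularized] at h1 ⊢
  linarith

/-- PL of f at the point m y bounds Φ̂(m y) - ψ(y), and min Φ̂ ≤ Φ̂(m y). No minimax equality
enters. -/
theorem psi_pl (hm : IsRegularizedArgmin f l z m xs) (hp : PLCondition f μ) (y : Euc d₂) :
    2 * μ * (primal f xs + l * ‖xs - z‖ ^ 2 - regularized f l z (m y) y)
      ≤ ‖gradY f (m y) y‖ ^ 2 := by
  have h1 := hp.pl (m y) y
  have h2 := hm.argmin_primal (m y)
  refine le_trans (mul_le_mul_of_nonneg_left ?_ (by linarith [hp.pos])) h1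
  simp only [regularized]
  linarith

/-- ψ is squeezed at y between the bound of `psi_lower` and f̂(m y, ·). Measurability of the
potential rests on this, since `m` is an arbitrary choice of minimizers. -/
theorem continuous_psi (hm : IsRegularizedArgmin f l z m xs) (hf : LipschitzSmooth f l) :
    Continuous fun y => regularized f l z (m y) y := by
  refine continuous_iff_continuousAt.mpr fun y => ?_
  have h1 : Continuous fun y' => regularized f l z (m y) y' :=
    (hf.continuous_regularized z).comp (Continuous.prodMk_right (m y))
  have h2 : Continuous fun y' => regularized f l z (m y) y + inner ℝ (gradY f (m y) y) (y' - y)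
      - l * ‖y' - y‖ ^ 2 := by fun_prop
  refine tendsto_of_tendsto_of_tendsto_of_le_of_le (by simpa using h2.tendsto y) (h1.tendsto y)
    (fun y' => hm.psi_lower hf y y') fun y' => hm.argmin y' (m y)

theorem continuous_lyapunov (hm : IsRegularizedArgmin f l z m xs) (hf : LipschitzSmooth f l)
    (c : ℝ) : Continuous fun p : Euc d₁ × Euc d₂ => lyapunov f l z m xs c p.1 p.2 := by
  have h1 := (hm.continuous_psi hf).comp (continuous_snd (X := Euc d₁) (Y := Euc d₂))
  have h2 := hf.continuous_regularized z
  exact (continuous_const.sub h1).add (continuous_const.mul (h2.sub h1))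

theorem lyapunov_nonneg (hm : IsRegularizedArgmin f l z m xs) (hp : PLCondition f μ) {c : ℝ}
    (hc : 0 ≤ c) (x : Euc d₁) (y : Euc d₂) : 0 ≤ lyapunov f l z m xs c x y := by
  have h1 := hm.psi_le hp y
  have h2 := mul_nonneg hc (sub_nonneg.mpr (hm.argmin y x))
  rw [lyapunov]; linarith

/-- Both x and xs are compared with m y: by strong convexity their squared distances to it are at
most 2/l times the second and the first gap. This gives 4 times the sum of the gaps, and the weight
1/4 turns 4 into 16. -/
theorem sq_dist_le (hm : IsRegularizedArgmin f l z m xs) (hf : LipschitzSmooth f l)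
    (hp : PLCondition f μ) (x : Euc d₁) (y : Euc d₂) :
    l * ‖x - xs‖ ^ 2 ≤ 16 * lyapunov f l z m xs (1 / 4) x y := by
  have h1 := hm.growth hf x y
  have h2 := hm.growth hf xs y
  have h3 := hp.le_primal xs y
  have h4 := hm.psi_le hp y
  have h5 := norm_sub_sq_le_two_mul (x - m y) (xs - m y)
  rw [sub_sub_sub_cancel_right] at h5
  have h6 := mul_le_mul_of_nonneg_left h5 hf.pos.le
  have h7 : regularized f l z xs y ≤ primal f xs + l * ‖xs - z‖ ^ 2 := by
    rw [regularized]; linarith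
  rw [lyapunov]
  linarith

/-- Here P and A are the two gaps, N = ‖g‖² and a = ⟨g, G⟩ for the y-gradients g at x and G at m y.
With s = lτ the weight of A grows by (1 + c)s ≤ 5s/4, so the reserve 6s/4 in c leaves s/4 ≥ μτ/4 for
the contraction. This is the origin of the 6. -/
theorem dual_step_coefficients {l μ τ P A N a : ℝ} (hl : 0 < l) (hμ : 0 < μ) (hμl : μ ≤ l)
    (hτ : 0 < τ) (hτl : 18 * (l * τ) ≤ 1) (hP : 0 ≤ P) (hA : 0 ≤ A) (hN : 0 ≤ N)
    (ha : -a ≤ -(N / 2) - μ * P + l * A) :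
    P + (1 - 6 * (l * τ)) / 4 * A
        + τ * ((1 - 6 * (l * τ)) / 4 * N - (1 + (1 - 6 * (l * τ)) / 4) * a)
        + l * τ ^ 2 * (1 + 3 / 2 * ((1 - 6 * (l * τ)) / 4)) * N
      ≤ (1 - μ * τ) * (P + 1 / 4 * A) := by
  obtain ⟨s, hs⟩ : ∃ s, s = l * τ := ⟨_, rfl⟩
  obtain ⟨c, hc⟩ : ∃ c, c = (1 - 6 * s) / 4 := ⟨_, rfl⟩
  have hs0 : 0 < s := hs ▸ mul_pos hl hτ
  rw [← hs] at hτl ⊢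
  rw [← hc]
  have hc0 : 0 ≤ c := by linarith
  have ha' := mul_le_mul_of_nonneg_left ha (by positivity : 0 ≤ τ * (1 + c))
  have hcoef : τ * N * (c - (1 + c) / 2 + s * (1 + 3 / 2 * c)) ≤ 0 := by
    refine mul_nonpos_of_nonneg_of_nonpos (by positivity) ?_
    nlinarith
  have hPc : 0 ≤ c * (μ * τ * P) := by positivity
  have hAc : (c + (1 + c) * s) * A ≤ (1 - μ * τ) * (1 / 4) * A := by
    refine mul_le_mul_of_nonneg_right ?_ hA
    have : μ * τ ≤ s := hs ▸ mul_le_mul_of_nonneg_right hμl hτ.le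
    nlinarith
  have h1 : l * τ ^ 2 * (1 + 3 / 2 * c) * N = τ * N * (s * (1 + 3 / 2 * c)) := by
    rw [hs]; ring
  have h2 : τ * (1 + c) * (l * A) = (1 + c) * s * A := by rw [hs]; ring
  linarith

/-- The dual half-step of AGDA, with gradient error `n`. -/
theorem exists_dual_step_le (hm : IsRegularizedArgmin f l z m xs) (hf : LipschitzSmooth f l)
    (hp : PLCondition f μ) (hμl : μ ≤ l) {τ : ℝ} (hτ : 0 < τ) (hτl : 18 * (l * τ) ≤ 1)
    (x : Euc d₁) (y : Euc d₂) :
    ∃ v, ∀ n, lyapunov f l z m xs ((1 - 6 * (l * τ)) / 4) x (y + τ • (gradY f x y + n))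
      ≤ (1 - μ * τ) * lyapunov f l z m xs (1 / 4) x y + inner ℝ v n
        + 2 * l * τ ^ 2 * ‖n‖ ^ 2 := by
  have hl := hf.pos
  have hμ := hp.pos
  set g := gradY f x y with hg
  set G := gradY f (m y) y with hG
  set c := (1 - 6 * (l * τ)) / 4 with hc
  have hs0 : 0 < l * τ := mul_pos hl hτ
  have hc0 : 0 ≤ c := by linarith
  have hc1 : c ≤ 1 / 4 := by linarith
  set B := l * τ ^ 2 * (1 + 3 / 2 * c) with hB
  refine ⟨τ • (c • g - (1 + c) • G) + (2 * B) • g, fun n => ?_⟩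
  set w := g + n with hw
  have h1 := hm.psi_lower hf y (y + τ • w)
  have h2 := hf.le_quadratic_y x y (y + τ • w)
  have h3 := hm.psi_pl hp y
  have h4 := hm.psi_le hp y
  have h5 := hm.growth hf x y
  -- The ascent direction is taken at x, but ψ responds to the gradient at m y; the discrepancy is
  -- paid for by the gap A.
  have h6 : ‖g - G‖ ^ 2 ≤ l ^ 2 * ‖x - m y‖ ^ 2 := by
    rw [← mul_pow]
    refine pow_le_pow_left₀ (norm_nonneg _) ?_ 2
    simpa using hf.lipschitz_gradY x (m y) y y
  rw [add_sub_cancel_left, norm_smul, inner_smul_right, mul_pow, Real.norm_eq_abs, sq_abs]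
    at h1 h2
  rw [← hG] at h1 h3
  rw [← hg] at h2
  set P := primal f xs + l * ‖xs - z‖ ^ 2 - regularized f l z (m y) y with hP
  set A := regularized f l z x y - regularized f l z (m y) y with hA
  have hP0 : 0 ≤ P := by linarith
  have hA0 : 0 ≤ A := le_trans (by positivity) h5
  have h7 : ‖g - G‖ ^ 2 ≤ 2 * l * A := by nlinarith
  have h8 : ‖g - G‖ ^ 2 = ‖g‖ ^ 2 - 2 * inner ℝ g G + ‖G‖ ^ 2 := norm_sub_sq_real g G
  have h9 : ‖w‖ ^ 2 = ‖g‖ ^ 2 + 2 * inner ℝ g n + ‖n‖ ^ 2 := norm_add_sq_real g n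
  have h10 : inner ℝ g w = ‖g‖ ^ 2 + inner ℝ g n := by
    rw [hw, inner_add_right, real_inner_self_eq_norm_sq]
  have h11 : inner ℝ G w = inner ℝ g G + inner ℝ G n := by
    rw [hw, inner_add_right, real_inner_comm]
  have h12 : inner ℝ (τ • (c • g - (1 + c) • G) + (2 * B) • g) n
      = τ * (c * inner ℝ g n - (1 + c) * inner ℝ G n) + 2 * B * inner ℝ g n := by
    rw [inner_add_left, real_inner_smul_left, real_inner_smul_left, inner_sub_left,
      real_inner_smul_left, real_inner_smul_left]
  -- In y the potential is a constant plus c·f̂(x, ·) - (1 + c)ψ. The curvatures add up to cl/2 + (1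
  -- + c)l = l(1 + 3c/2), which is the factor in B.
  have hbound : lyapunov f l z m xs c x (y + τ • w)
      ≤ P + c * A + τ * (c * inner ℝ g w - (1 + c) * inner ℝ G w) + B * ‖w‖ ^ 2 := by
    have h13 : regularized f l z x (y + τ • w) ≤ regularized f l z x y
        + τ * inner ℝ g w + l / 2 * (τ ^ 2 * ‖w‖ ^ 2) := by
      simp only [regularized]; linarith
    have h14 := mul_le_mul_of_nonneg_left h13 hc0
    have h15 := mul_le_mul_of_nonneg_left h1 (by linarith : 0 ≤ 1 + c)
    rw [lyapunov, hP, hA, hB]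
    linarith
  have hfin := dual_step_coefficients hl hμ hμl hτ hτl hP0 hA0 (sq_nonneg ‖g‖)
    (by linarith : -inner ℝ g G ≤ -(‖g‖ ^ 2 / 2) - μ * P + l * A)
  have hB2 : B * ‖n‖ ^ 2 ≤ 2 * l * τ ^ 2 * ‖n‖ ^ 2 := by
    refine mul_le_mul_of_nonneg_right ?_ (sq_nonneg _)
    have h13 : 0 ≤ l * τ ^ 2 := by positivity
    have h14 := mul_le_mul_of_nonneg_left hc1 h13
    rw [hB]; linarith
  rw [← hc, ← hB] at hfin
  have hV : lyapunov f l z m xs (1 / 4) x y = P + 1 / 4 * A := rfl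
  rw [hV, h12]
  rw [h9, h10, h11] at hbound
  linarith

/-- The primal half-step of AGDA, with gradient error `n`. -/
theorem exists_primal_step_le (hm : IsRegularizedArgmin f l z m xs) (hf : LipschitzSmooth f l)
    {τ : ℝ} (hτ : 0 < τ) (hτl : 18 * (l * τ) ≤ 1) (x : Euc d₁) (y : Euc d₂) :
    ∃ v, ∀ n, lyapunov f l z m xs (1 / 4) (x - (6 * τ) • (regularizedGradX f l z x y + n)) y
      ≤ lyapunov f l z m xs ((1 - 6 * (l * τ)) / 4) x y + inner ℝ v n
        + 14 * l * τ ^ 2 * ‖n‖ ^ 2 := by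
  have hl := hf.pos
  set g := regularizedGradX f l z x y with hg
  refine ⟨(1 / 4 : ℝ) • ((108 * l * τ ^ 2 - 6 * τ) • g), fun n => ?_⟩
  set w := g + n with hw
  have h1 := hf.regularized_le_quadratic z x (x - (6 * τ) • w) y
  have h2 := hm.gap_le hf x y
  rw [le_div_iff₀ (by positivity)] at h2
  rw [show x - (6 * τ) • w - x = -((6 * τ) • w) by abel, norm_neg, norm_smul, inner_neg_right,
    inner_smul_right, mul_pow, Real.norm_eq_abs, sq_abs, ← hg] at h1
  rw [← hg] at h2
  have h9 : ‖w‖ ^ 2 = ‖g‖ ^ 2 + 2 * inner ℝ g n + ‖n‖ ^ 2 := norm_add_sq_real g n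
  have h10 : inner ℝ g w = ‖g‖ ^ 2 + inner ℝ g n := by
    rw [hw, inner_add_right, real_inner_self_eq_norm_sq]
  rw [h9, h10] at h1
  rw [real_inner_smul_left, real_inner_smul_left]
  -- The step 6τ decreases f̂ by 6τ(1 - 9lτ)‖g‖² ≥ 3τ‖g‖², hence by at least 6lτ times the gap. This
  -- is where 18lτ ≤ 1 is needed.
  have h3 : 0 ≤ τ * ‖g‖ ^ 2 * (1 - 18 * (l * τ)) :=
    mul_nonneg (by positivity) (by linarith)
  have h4 := mul_le_mul_of_nonneg_left h2 hτ.le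
  have h5 : 0 ≤ l * τ ^ 2 * ‖n‖ ^ 2 := by positivity
  rw [lyapunov, lyapunov]
  linarith

theorem regularizedGradX_primal_eq_zero (hm : IsRegularizedArgmin f l z m xs)
    (hf : LipschitzSmooth f l) (hp : PLCondition f μ) {ys : Euc d₂} (hys : f xs ys = primal f xs) :
    regularizedGradX f l z xs ys = 0 := by
  have hl := hf.pos
  have hμ := hp.pos
  refine eq_zero_of_isMin_of_le_quadratic (h := fun x => primal f x + l * ‖x - z‖ ^ 2)
    (c := l / 2 + l ^ 2 / (2 * μ) + l) (by positivity) hm.argmin_primal fun x => ?_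
  have h1 := PLCondition.primal_le_quadratic hf hp hys x
  simp only [norm_sub_sq_expand xs x z, regularizedGradX, inner_add_left, real_inner_smul_left]
  linarith

/-- The duality gap at an approximately stationary pair. -/
theorem duality_gap_le (hm : IsRegularizedArgmin f l z m xs) (hf : LipschitzSmooth f l)
    (hp : PLCondition f μ) {ε : ℝ} {y : Euc d₂} (hx : ‖gradX f z y‖ ^ 2 ≤ ε ^ 2)
    (hy : l * ‖gradY f z y‖ ^ 2 ≤ μ * ε ^ 2) :
    l * (regularized f l z z y - regularized f l z (m y) y) ≤ ε ^ 2 / 2 ∧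
      l * (primal f z - regularized f l z (m y) y) ≤ ε ^ 2 := by
  have hl := hf.pos
  have hμ := hp.pos
  have h1 := hm.gap_le hf z y
  have h2 : regularizedGradX f l z z y = gradX f z y := by simp [regularizedGradX]
  rw [h2, le_div_iff₀ (by positivity)] at h1
  have h3 : l * (regularized f l z z y - regularized f l z (m y) y) ≤ ε ^ 2 / 2 := by linarith
  refine ⟨h3, ?_⟩
  -- The scaling ε/√κ in y makes Φ(z) - f(z, y) at most ε²/(2l), the same size as the gap in x.
  have h4 := mul_le_mul_of_nonneg_left (hp.pl z y) hl.le
  have h5 : μ * (2 * (l * (primal f z - f z y))) ≤ μ * ε ^ 2 := by linarith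
  have h6 := le_of_mul_le_mul_left h5 hμ
  have h7 : regularized f l z z y = f z y := by simp [regularized]
  rw [h7] at h3
  linarith

theorem lyapunov_init_le (hm : IsRegularizedArgmin f l z m xs) (hf : LipschitzSmooth f l)
    (hp : PLCondition f μ) {ε : ℝ} {y : Euc d₂} (hx : ‖gradX f z y‖ ^ 2 ≤ ε ^ 2)
    (hy : l * ‖gradY f z y‖ ^ 2 ≤ μ * ε ^ 2) :
    l * lyapunov f l z m xs (1 / 4) z y ≤ 2 * ε ^ 2 := by
  obtain ⟨h1, h2⟩ := hm.duality_gap_le hf hp hx hy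
  have h3 := mul_le_mul_of_nonneg_left (hm.argmin_primal z) hf.pos.le
  rw [sub_self, norm_zero] at h3
  rw [lyapunov]
  nlinarith [sq_nonneg ε]

/-- With ys a maximizer at xs, f̂(·, ys) is strongly convex and critical at xs, where its value is
min Φ̂ ≥ ψ(y); at z its value is at most Φ(z). So l/2‖xs - z‖² is below the duality gap. -/
theorem sq_dist_center_le (hm : IsRegularizedArgmin f l z m xs) (hf : LipschitzSmooth f l)
    (hp : PLCondition f μ) {ε : ℝ} {y : Euc d₂} (hx : ‖gradX f z y‖ ^ 2 ≤ ε ^ 2)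
    (hy : l * ‖gradY f z y‖ ^ 2 ≤ μ * ε ^ 2) :
    l ^ 2 * ‖xs - z‖ ^ 2 ≤ 2 * ε ^ 2 := by
  have hl := hf.pos
  obtain ⟨ys, hys⟩ := hp.exists_eq_primal xs
  obtain ⟨-, h2⟩ := hm.duality_gap_le hf hp hx hy
  have h3 := hf.quadratic_le_regularized z xs z ys
  rw [hm.regularizedGradX_primal_eq_zero hf hp hys, inner_zero_left, norm_sub_rev z xs] at h3
  have h4 := hm.psi_le hp y
  have h5 := hp.le_primal z ys
  have h6 : regularized f l z xs ys = primal f xs + l * ‖xs - z‖ ^ 2 := by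
    rw [← hys]; rfl
  have h7 : regularized f l z z ys = f z ys := by simp [regularized]
  have h8 : l / 2 * ‖xs - z‖ ^ 2 ≤ primal f z - regularized f l z (m y) y := by linarith
  have h9 := mul_le_mul_of_nonneg_left h8 hl.le
  nlinarith

theorem norm_gradient_primal_sq_le (hm : IsRegularizedArgmin f l z m xs)
    (hf : LipschitzSmooth f l) (hp : PLCondition f μ) (hμl : μ ≤ l) {ε : ℝ} {y₀ : Euc d₂}
    (hx : ‖gradX f z y₀‖ ^ 2 ≤ ε ^ 2) (hy : l * ‖gradY f z y₀‖ ^ 2 ≤ μ * ε ^ 2)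
    (x : Euc d₁) (y : Euc d₂) :
    ‖gradient (primal f) x‖ ^ 2
      ≤ 16 * ε ^ 2 + 512 * (l / μ) ^ 2 * l * lyapunov f l z m xs (1 / 4) x y := by
  have hl := hf.pos
  have hμ := hp.pos
  obtain ⟨ys, hys⟩ := hp.exists_eq_primal xs
  have h0 : ‖gradient (primal f) xs‖ ^ 2 ≤ 8 * ε ^ 2 := by
    have h1 := hm.regularizedGradX_primal_eq_zero hf hp hys
    rw [regularizedGradX, add_eq_zero_iff_eq_neg] at h1
    rw [PLCondition.gradient_primal hf hp hys, h1, norm_neg, norm_smul, mul_pow,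
      Real.norm_eq_abs, sq_abs]
    linarith [hm.sq_dist_center_le hf hp hx hy]
  have hκ : 1 ≤ l / μ := by rwa [le_div_iff₀ hμ, one_mul]
  have h1 := PLCondition.lipschitz_gradient_primal hf hp xs x
  have h2 : ‖gradient (primal f) x - gradient (primal f) xs‖ ≤ 4 * (l / μ) * l * ‖x - xs‖ := by
    refine h1.trans (mul_le_mul_of_nonneg_right ?_ (norm_nonneg _))
    nlinarith
  have h3 := pow_le_pow_left₀ (norm_nonneg _) h2 2
  have h4 := norm_add_sq_le_two_mul (gradient (primal f) x - gradient (primal f) xs)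
    (gradient (primal f) xs)
  rw [sub_add_cancel] at h4
  have h5 := mul_le_mul_of_nonneg_left (hm.sq_dist_le hf hp x y)
    (by positivity : 0 ≤ 32 * (l / μ) ^ 2 * l)
  nlinarith

end IsRegularizedArgmin
end

/-! ### Fresh samples and expectations -/

noncomputable section

section Probability

variable {ι Ω Ξ S : Type*} [MeasurableSpace Ξ]

/-- The σ-algebra generated by the samples with index in `s`. -/
abbrev samplesSigma (ξ : ι → Ω → Ξ) (s : Set ι) : MeasurableSpace Ω :=
  ⨆ i ∈ s, MeasurableSpace.comap (ξ i) inferInstance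

theorem samplesSigma_mono (ξ : ι → Ω → Ξ) {s t : Set ι} (h : s ⊆ t) :
    samplesSigma ξ s ≤ samplesSigma ξ t :=
  biSup_mono h

theorem measurable_samplesSigma (ξ : ι → Ω → Ξ) {s : Set ι} {i : ι} (hi : i ∈ s) :
    Measurable[samplesSigma ξ s] (ξ i) :=
  measurable_iff_comap_le.mpr
    (le_biSup (fun i => MeasurableSpace.comap (ξ i) inferInstance) hi)

variable [MeasurableSpace Ω] [MeasurableSpace S] {Q : Measure Ω} {P : Measure Ξ}

/-- The recursions run on lower Lebesgue integrals, so no integrability of the iterates has to be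
carried along; it is recovered at the end. -/
theorem lintegral_ofReal_affine_le [IsProbabilityMeasure Q] {V : Ω → ℝ} {q b c : ℝ}
    (hV : ∀ ω, 0 ≤ V ω) (hq : 0 ≤ q)
    (hb : 0 ≤ b) (hc : 0 ≤ c) (h : ∫⁻ ω, ENNReal.ofReal (V ω) ∂Q ≤ ENNReal.ofReal b) :
    ∫⁻ ω, ENNReal.ofReal (q * V ω + c) ∂Q ≤ ENNReal.ofReal (q * b + c) := by
  have h1 : ∀ ω, ENNReal.ofReal (q * V ω + c)
      = ENNReal.ofReal q * ENNReal.ofReal (V ω) + ENNReal.ofReal c := fun ω => by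
    rw [ENNReal.ofReal_add (mul_nonneg hq (hV ω)) hc, ENNReal.ofReal_mul hq]
  simp_rw [h1]
  rw [lintegral_add_right _ measurable_const, lintegral_const_mul' _ _ ENNReal.ofReal_ne_top,
    lintegral_const, measure_univ, mul_one, ENNReal.ofReal_add (mul_nonneg hq hb) hc,
    ENNReal.ofReal_mul hq]
  gcongr

theorem integrable_and_integral_le_of_lintegral {h : Ω → ℝ} {B : ℝ} (hm : Measurable h)
    (h0 : ∀ ω, 0 ≤ h ω) (hB : 0 ≤ B) (hle : ∫⁻ ω, ENNReal.ofReal (h ω) ∂Q ≤ ENNReal.ofReal B) :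
    Integrable h Q ∧ ∫ ω, h ω ∂Q ≤ B := by
  constructor
  · refine ⟨hm.aestronglyMeasurable, ?_⟩
    rw [hasFiniteIntegral_iff_ofReal (Filter.Eventually.of_forall h0)]
    exact hle.trans_lt ENNReal.ofReal_lt_top
  · rw [integral_eq_lintegral_of_nonneg_ae (Filter.Eventually.of_forall h0)
      hm.aestronglyMeasurable]
    exact ENNReal.toReal_le_of_le_ofReal hB hle

/-- The expectation of a nonnegative function bounded by a quadratic in centred noise. -/
theorem lintegral_ofReal_le_of_quadratic_noise [IsProbabilityMeasure P]
    {E : Type*} [NormedAddCommGroup E]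
    [InnerProductSpace ℝ E] [CompleteSpace E] {n : Ξ → E} {σ a b : ℝ} {v : E} {h : Ξ → ℝ}
    (hn : Integrable n P) (hn0 : ∫ ξ, n ξ ∂P = 0) (hn2 : Integrable (fun ξ => ‖n ξ‖ ^ 2) P)
    (hσ : ∫ ξ, ‖n ξ‖ ^ 2 ∂P ≤ σ ^ 2) (hb : 0 ≤ b) (h0 : ∀ ξ, 0 ≤ h ξ)
    (hle : ∀ ξ, h ξ ≤ a + inner ℝ v (n ξ) + b * ‖n ξ‖ ^ 2) :
    ∫⁻ ξ, ENNReal.ofReal (h ξ) ∂P ≤ ENNReal.ofReal (a + b * σ ^ 2) := by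
  have hi1 : Integrable (fun ξ => a + inner ℝ v (n ξ)) P :=
    (integrable_const a).add (hn.const_inner v)
  have hi2 : Integrable (fun ξ => b * ‖n ξ‖ ^ 2) P := hn2.const_mul b
  calc ∫⁻ ξ, ENNReal.ofReal (h ξ) ∂P
      ≤ ∫⁻ ξ, ENNReal.ofReal (a + inner ℝ v (n ξ) + b * ‖n ξ‖ ^ 2) ∂P :=
        lintegral_mono fun ξ => ENNReal.ofReal_le_ofReal (hle ξ)
    _ = ENNReal.ofReal (∫ ξ, (a + inner ℝ v (n ξ) + b * ‖n ξ‖ ^ 2) ∂P) :=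
        (ofReal_integral_eq_lintegral_ofReal (hi1.add hi2)
          (Filter.Eventually.of_forall fun ξ => (h0 ξ).trans (hle ξ))).symm
    _ ≤ ENNReal.ofReal (a + b * σ ^ 2) := by
        refine ENNReal.ofReal_le_ofReal ?_
        rw [integral_add hi1 hi2, integral_add (integrable_const a) (hn.const_inner v),
          integral_const_mul, integral_inner hn, hn0, inner_zero_right, integral_const,
          probReal_univ, one_smul, add_zero]
        exact add_le_add_right (mul_le_mul_of_nonneg_left hσ hb) a

namespace IIDSamples

variable {ξ : ι → Ω → Ξ}

theorem samplesSigma_le (hξ : IIDSamples Q P ξ) (s : Set ι) :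
    samplesSigma ξ s ≤ (inferInstance : MeasurableSpace Ω) :=
  iSup₂_le fun i _ => (hξ.measurable i).comap_le

/-- Conditioning on a state that depends on the samples in `s`, one fresh sample is drawn. -/
theorem lintegral_fresh_le [IsProbabilityMeasure Q] [IsProbabilityMeasure P]
    (hξ : IIDSamples Q P ξ) {s : Set ι} {i : ι} (hi : i ∉ s) {X : Ω → S}
    (hX : Measurable[samplesSigma ξ s] X) {h : S × Ξ → ENNReal} (hh : Measurable h)
    {H : S → ENNReal} (hH : ∀ x, ∫⁻ u, h (x, u) ∂P ≤ H x) :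
    ∫⁻ ω, h (X ω, ξ i ω) ∂Q ≤ ∫⁻ ω, H (X ω) ∂Q := by
  have hX' : Measurable X := hX.mono (hξ.samplesSigma_le s) le_rfl
  have hind : IndepFun X (ξ i) Q := by
    have h1 := indep_iSup_of_disjoint (fun i => (hξ.measurable i).comap_le) hξ.indep
      (Set.disjoint_singleton_right.mpr hi)
    rw [IndepFun_iff_Indep]
    refine indep_of_indep_of_le_left (indep_of_indep_of_le_right h1 ?_)
      (measurable_iff_comap_le.mp hX)
    exact le_biSup (fun i => MeasurableSpace.comap (ξ i) inferInstance) (Set.mem_singleton i)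
  have hmap := (indepFun_iff_map_prod_eq_prod_map_map hX'.aemeasurable
    (hξ.measurable i).aemeasurable).mp hind
  rw [hξ.law i] at hmap
  calc ∫⁻ ω, h (X ω, ξ i ω) ∂Q = ∫⁻ p, h p ∂(Q.map fun ω => (X ω, ξ i ω)) :=
        (lintegral_map hh (hX'.prodMk (hξ.measurable i))).symm
    _ = ∫⁻ x, ∫⁻ u, h (x, u) ∂P ∂(Q.map X) := by
        rw [hmap, lintegral_prod _ hh.aemeasurable]
    _ = ∫⁻ ω, ∫⁻ u, h (X ω, u) ∂P ∂Q := lintegral_map hh.lintegral_prod_right' hX'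
    _ ≤ ∫⁻ ω, H (X ω) ∂Q := lintegral_mono fun ω => hH (X ω)

end IIDSamples

end Probability

/-- The k + 1 allows K to be a floor, at the price of one factor e < 3. Rounding up would break the
bound on K when the logarithm is small and positive. -/
theorem one_sub_pow_mul_sq_le_three {s t : ℝ} {k : ℕ} (hs1 : s ≤ 1)
    (h : 2 * Real.posLog t ≤ (k + 1) * s) : (1 - s) ^ k * t ^ 2 ≤ 3 := by
  have h1 : (1 - s) ^ k ≤ Real.exp (-(k * s)) := by
    have := pow_le_pow_left₀ (by linarith) (Real.one_sub_le_exp_neg s) k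
    rwa [← Real.exp_nat_mul, mul_neg] at this
  have h2 : t ^ 2 ≤ Real.exp (2 * Real.posLog t) := by
    rcases eq_or_ne t 0 with rfl | ht
    · rw [zero_pow two_ne_zero]; positivity
    · rw [← sq_abs, ← Real.exp_log (abs_pos.mpr ht), ← Real.exp_nat_mul, Real.log_abs]
      refine Real.exp_le_exp.mpr ?_
      push_cast
      have : Real.log t ≤ Real.posLog t := le_max_right _ _
      linarith
  calc (1 - s) ^ k * t ^ 2
      ≤ Real.exp (-(k * s)) * Real.exp (2 * Real.posLog t) :=
        mul_le_mul h1 h2 (sq_nonneg t) (Real.exp_pos _).le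
    _ = Real.exp (2 * Real.posLog t - k * s) := by rw [← Real.exp_add]; congr 1; ring
    _ ≤ Real.exp 1 := Real.exp_le_exp.mpr (by linarith)
    _ ≤ 3 := by linarith [Real.exp_one_lt_d9]

variable {d₁ d₂ : ℕ} {f : Euc d₁ → Euc d₂ → ℝ} {l μ σ : ℝ} {Ξ Ω : Type*} [MeasurableSpace Ξ]
  {P : Measure Ξ} {Gx : Euc d₁ → Euc d₂ → Ξ → Euc d₁}
  {Gy : Euc d₁ → Euc d₂ → Ξ → Euc d₂}

namespace StochasticGradients

theorem lintegral_le_of_noise_Gx [IsProbabilityMeasure P]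
    (hG : StochasticGradients f P Gx Gy σ) {x : Euc d₁} {y : Euc d₂}
    {a b : ℝ} {v : Euc d₁} {h : Ξ → ℝ} (hb : 0 ≤ b) (h0 : ∀ u, 0 ≤ h u)
    (hle : ∀ u, h u ≤ a + inner ℝ v (Gx x y u - gradX f x y) + b * ‖Gx x y u - gradX f x y‖ ^ 2) :
    ∫⁻ u, ENNReal.ofReal (h u) ∂P ≤ ENNReal.ofReal (a + b * σ ^ 2) := by
  refine lintegral_ofReal_le_of_quadratic_noise ((hG.integrable_Gx x y).sub (integrable_const _))
    ?_ (hG.integrable_sq_Gx x y) (hG.variance_Gx x y) hb h0 hle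
  change ∫ u, (Gx x y u - gradX f x y) ∂P = 0
  rw [integral_sub (hG.integrable_Gx x y) (integrable_const _), hG.unbiased_Gx]
  simp

theorem lintegral_le_of_noise_Gy [IsProbabilityMeasure P]
    (hG : StochasticGradients f P Gx Gy σ) {x : Euc d₁} {y : Euc d₂}
    {a b : ℝ} {v : Euc d₂} {h : Ξ → ℝ} (hb : 0 ≤ b) (h0 : ∀ u, 0 ≤ h u)
    (hle : ∀ u, h u ≤ a + inner ℝ v (Gy x y u - gradY f x y) + b * ‖Gy x y u - gradY f x y‖ ^ 2) :
    ∫⁻ u, ENNReal.ofReal (h u) ∂P ≤ ENNReal.ofReal (a + b * σ ^ 2) := by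
  refine lintegral_ofReal_le_of_quadratic_noise ((hG.integrable_Gy x y).sub (integrable_const _))
    ?_ (hG.integrable_sq_Gy x y) (hG.variance_Gy x y) hb h0 hle
  change ∫ u, (Gy x y u - gradY f x y) ∂P = 0
  rw [integral_sub (hG.integrable_Gy x y) (integrable_const _), hG.unbiased_Gy]
  simp

end StochasticGradients

/-! ### Gradient ascent at fixed x -/

section Ascent

variable {ξ : ℕ → Ω → Ξ} {x : Euc d₁} {y₀ : Euc d₂} {τ : ℝ}

theorem exists_ascent_step_le (hf : LipschitzSmooth f l) (hp : PLCondition f μ) (hτ : 0 < τ)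
    (hτl : l * τ ≤ 1) (x : Euc d₁) (y : Euc d₂) :
    ∃ v, ∀ n, primal f x - f x (y + τ • (gradY f x y + n))
      ≤ (1 - μ * τ) * (primal f x - f x y) + inner ℝ v n + l * τ ^ 2 / 2 * ‖n‖ ^ 2 := by
  set g := gradY f x y with hg
  -- This vector collects the terms linear in n. It does not depend on n, so they vanish in
  -- expectation.
  refine ⟨(l * τ ^ 2 - τ) • g, fun n => ?_⟩
  have h1 := hf.quadratic_le_y x y (y + τ • (g + n))
  have h2 := hp.pl x y
  rw [add_sub_cancel_left, norm_smul, inner_smul_right, mul_pow, Real.norm_eq_abs, sq_abs, ← hg,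
    norm_add_sq_real, inner_add_right, real_inner_self_eq_norm_sq] at h1
  rw [← hg] at h2
  rw [real_inner_smul_left]
  have h3 : 0 ≤ τ * ‖g‖ ^ 2 * (1 - l * τ) := mul_nonneg (by positivity) (by linarith)
  have h4 := mul_le_mul_of_nonneg_left h2 hτ.le
  linarith

theorem measurable_stochGradientAscent (hG : StochasticGradients f P Gx Gy σ) (k : ℕ) :
    Measurable[samplesSigma ξ {i | i < k}]
      fun ω => stochGradientAscent Gy x τ y₀ (fun i => ξ i ω) k := by
  induction k with
  | zero => exact measurable_const
  | succ k ih =>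
    have h1 : Measurable[samplesSigma ξ {i | i < k + 1}]
        fun ω => stochGradientAscent Gy x τ y₀ (fun i => ξ i ω) k :=
      ih.mono (samplesSigma_mono ξ fun i hi => Nat.lt_succ_of_lt hi) le_rfl
    have h2 : Measurable[samplesSigma ξ {i | i < k + 1}] (ξ k) :=
      measurable_samplesSigma ξ (Nat.lt_succ_self k)
    have h3 : Measurable fun p : Euc d₂ × Ξ => p.1 + τ • Gy x p.1 p.2 :=
      measurable_fst.add ((hG.measurable_Gy.comp
        (measurable_const.prodMk measurable_id)).const_smul τ)
    exact h3.comp (h1.prodMk h2)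

variable [MeasurableSpace Ω] {Q : Measure Ω}

/-- The additive error κτσ²/2 is the fixed point of e ↦ (1 - μτ)e + lτ²σ²/2. -/
theorem lintegral_stochGradientAscent_gap_le [IsProbabilityMeasure P] [IsProbabilityMeasure Q]
    (hf : LipschitzSmooth f l) (hp : PLCondition f μ)
    (hG : StochasticGradients f P Gx Gy σ) (hξ : IIDSamples Q P ξ) (hμl : μ ≤ l) (hτ : 0 < τ)
    (hτl : l * τ ≤ 1) (k : ℕ) :
    ∫⁻ ω, ENNReal.ofReal (primal f x
        - f x (stochGradientAscent Gy x τ y₀ (fun i => ξ i ω) k)) ∂Q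
      ≤ ENNReal.ofReal ((1 - μ * τ) ^ k * (primal f x - f x y₀) + l / μ * τ * σ ^ 2 / 2) := by
  have hl := hf.pos
  have hμ := hp.pos
  have hgap : ∀ y, 0 ≤ primal f x - f x y := fun y => sub_nonneg.mpr (hp.le_primal x y)
  have hq : 0 ≤ 1 - μ * τ := by
    have : μ * τ ≤ l * τ := mul_le_mul_of_nonneg_right hμl hτ.le
    linarith
  induction k with
  | zero =>
    simp only [stochGradientAscent, lintegral_const, measure_univ, mul_one, pow_zero, one_mul]
    refine ENNReal.ofReal_le_ofReal (le_add_of_nonneg_right (by positivity))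
  | succ k ih =>
    have hmeas : Measurable fun p : Euc d₂ × Ξ =>
        ENNReal.ofReal (primal f x - f x (p.1 + τ • Gy x p.1 p.2)) := by
      refine ENNReal.measurable_ofReal.comp (measurable_const.sub ?_)
      exact (hf.continuous_uncurry.comp (Continuous.prodMk_right x)).measurable.comp
        (measurable_fst.add ((hG.measurable_Gy.comp
          (measurable_const.prodMk measurable_id)).const_smul τ))
    refine (hξ.lintegral_fresh_le (s := {i | i < k}) (i := k) (by simp)
      (measurable_stochGradientAscent hG k) hmeas
      (H := fun y => ENNReal.ofReal ((1 - μ * τ) * (primal f x - f x y)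
        + l * τ ^ 2 / 2 * σ ^ 2)) fun y => ?_).trans ?_
    · obtain ⟨v, hv⟩ := exists_ascent_step_le hf hp hτ hτl x y
      refine hG.lintegral_le_of_noise_Gy (x := x) (y := y) (v := v) (by positivity)
        (fun u => hgap _) fun u => ?_
      simpa using hv (Gy x y u - gradY f x y)
    · refine (lintegral_ofReal_affine_le (fun ω => hgap _) hq ?_ (by positivity) ih).trans
        (ENNReal.ofReal_le_ofReal (le_of_eq ?_))
      · have := hgap y₀
        positivity
      · field_simp
        ring

/-- Stochastic gradient ascent turns a stationary point of the primal function into a stationary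
pair. -/
theorem isMeanStationaryPair_stochGradientAscent [IsProbabilityMeasure P] [IsProbabilityMeasure Q]
    (hf : LipschitzSmooth f l)
    (hp : PLCondition f μ) (hG : StochasticGradients f P Gx Gy σ) (hξ : IIDSamples Q P ξ)
    (hμl : μ ≤ l) (hτ : 0 < τ) (hτl : l * τ ≤ 1) {ε ε' : ℝ} (hε : 0 < ε)
    (hx : ‖gradient (primal f) x‖ ≤ ε) (hy : ‖gradY f x y₀‖ ≤ ε')
    (hσ : (l / μ) ^ 2 * (l * τ) * σ ^ 2 ≤ ε ^ 2) {k : ℕ}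
    (hk : 2 * Real.posLog (l / μ * ε' / ε) ≤ (k + 1) * (μ * τ)) :
    IsMeanStationaryPair Q f (200 * ε) (200 * ε) (fun _ => x)
      (fun ω => stochGradientAscent Gy x τ y₀ (fun i => ξ i ω) k) := by
  have hl := hf.pos
  have hμ := hp.pos
  have hμτ : μ * τ ≤ 1 := (mul_le_mul_of_nonneg_right hμl hτ.le).trans hτl
  have hq : 0 ≤ 1 - μ * τ := by linarith
  have hκ : 1 ≤ l / μ := by rwa [le_div_iff₀ hμ, one_mul]
  have hgap : ∀ y, 0 ≤ primal f x - f x y := fun y => sub_nonneg.mpr (hp.le_primal x y)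
  set b := (1 - μ * τ) ^ k * (primal f x - f x y₀) + l / μ * τ * σ ^ 2 / 2 with hb
  have hb0 : 0 ≤ b := by have := hgap y₀; positivity
  have hlint := lintegral_stochGradientAscent_gap_le (x := x) (y₀ := y₀) hf hp hG hξ hμl hτ hτl k
  have hbε : l / μ * l * b ≤ 2 * ε ^ 2 := by
    have h1 := one_sub_pow_mul_sq_le_three hμτ hk
    have h2 : (l / μ) ^ 2 * ‖gradY f x y₀‖ ^ 2 ≤ (l / μ * ε' / ε) ^ 2 * ε ^ 2 := by
      have : (l / μ * ε' / ε) ^ 2 * ε ^ 2 = (l / μ) ^ 2 * ε' ^ 2 := by field_simp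
      rw [this]
      gcongr
    have h3 : l / μ * l * (primal f x - f x y₀) ≤ (l / μ) ^ 2 * ‖gradY f x y₀‖ ^ 2 / 2 := by
      have := mul_le_mul_of_nonneg_left (hp.pl x y₀) (by positivity : 0 ≤ (l / μ) ^ 2 / 2)
      have h4 : (l / μ) ^ 2 / 2 * (2 * μ * (primal f x - f x y₀))
        = l / μ * l * (primal f x - f x y₀) := by field_simp
      linarith
    have h5 := mul_le_mul_of_nonneg_left (h3.trans (div_le_div_of_nonneg_right h2 zero_le_two))
      (pow_nonneg hq k)
    have h6 := mul_le_mul_of_nonneg_right h1 (sq_nonneg ε)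
    rw [hb]
    linarith
  have hYm : Measurable fun ω => stochGradientAscent Gy x τ y₀ (fun i => ξ i ω) k :=
    (measurable_stochGradientAscent hG k).mono (hξ.samplesSigma_le _) le_rfl
  constructor
  · refine integrable_and_integral_le_of_lintegral ?_ (fun ω => sq_nonneg _) (sq_nonneg _) ?_
    · exact ((hf.continuous_gradX.comp
        (Continuous.prodMk_right x)).measurable.comp hYm).norm.pow_const 2
    · refine (lintegral_mono fun ω => ENNReal.ofReal_le_ofReal (?_ : _ ≤ (18 * (l / μ * l))
        * (primal f x - f x (stochGradientAscent Gy x τ y₀ (fun i => ξ i ω) k))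
          + 2 * ε ^ 2)).trans ((lintegral_ofReal_affine_le (fun ω => hgap _) (by positivity) hb0
            (by positivity) hlint).trans (ENNReal.ofReal_le_ofReal ?_))
      · set y := stochGradientAscent Gy x τ y₀ (fun i => ξ i ω) k
        obtain ⟨ys, hys, hd⟩ := hp.exists_maximizer_near hf x y
        rw [PLCondition.gradient_primal hf hp hys] at hx
        have h1 := hf.lipschitz_gradX x x y ys
        rw [sub_self, norm_zero, zero_add] at h1
        have h2 := norm_add_sq_le_two_mul (gradX f x y - gradX f x ys) (gradX f x ys)
        rw [sub_add_cancel] at h2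
        have h3 := pow_le_pow_left₀ (norm_nonneg _) h1 2
        have h4 := pow_le_pow_left₀ (norm_nonneg _) hx 2
        have h5 := mul_le_mul_of_nonneg_left hd (by positivity : 0 ≤ l / μ * l)
        have h6 : l / μ * l * (μ * ‖y - ys‖ ^ 2) = (l * ‖y - ys‖) ^ 2 := by field_simp
        linarith
      · nlinarith [sq_nonneg ε]
  · refine integrable_and_integral_le_of_lintegral ?_ (fun ω => sq_nonneg _) (sq_nonneg _) ?_
    · exact ((hf.continuous_gradY.comp
        (Continuous.prodMk_right x)).measurable.comp hYm).norm.pow_const 2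
    · refine (lintegral_mono fun ω => ENNReal.ofReal_le_ofReal (?_ : _ ≤ (2 * (l / μ * l))
        * (primal f x - f x (stochGradientAscent Gy x τ y₀ (fun i => ξ i ω) k))
          + 0)).trans ((lintegral_ofReal_affine_le (fun ω => hgap _) (by positivity) hb0
            le_rfl hlint).trans (ENNReal.ofReal_le_ofReal ?_))
      · set y := stochGradientAscent Gy x τ y₀ (fun i => ξ i ω) k
        have h1 := hp.norm_gradY_sq_le hf x y
        have h2 := mul_le_mul_of_nonneg_right hκ (mul_nonneg hl.le (hgap y))
        linarith
      · nlinarith [sq_nonneg ε]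

end Ascent

/-! ### Alternating gradient descent ascent -/

section AGDA

variable {ξ : ℕ × Fin 2 → Ω → Ξ} {z : Euc d₁} {y₀ : Euc d₂} {τ : ℝ}

theorem measurable_regularizedGx (hG : StochasticGradients f P Gx Gy σ) (l : ℝ) (z : Euc d₁) :
    Measurable fun p : (Euc d₁ × Euc d₂) × Ξ => regularizedGx Gx l z p.1.1 p.1.2 p.2 := by
  have h1 : Measurable fun p : (Euc d₁ × Euc d₂) × Ξ => Gx p.1.1 p.1.2 p.2 :=
    hG.measurable_Gx.comp (f := fun p : (Euc d₁ × Euc d₂) × Ξ => (p.1.1, p.1.2, p.2))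
      (by fun_prop)
  exact h1.add (((measurable_fst.comp measurable_fst).sub_const z).const_smul (2 * l))

theorem measurable_dual_update (hG : StochasticGradients f P Gx Gy σ) (τ : ℝ) :
    Measurable fun p : (Euc d₁ × Euc d₂) × Ξ =>
      (p.1.1, p.1.2 + τ • Gy p.1.1 p.1.2 p.2) := by
  have h1 : Measurable fun p : (Euc d₁ × Euc d₂) × Ξ => Gy p.1.1 p.1.2 p.2 :=
    hG.measurable_Gy.comp (f := fun p : (Euc d₁ × Euc d₂) × Ξ => (p.1.1, p.1.2, p.2))
      (by fun_prop)
  exact (measurable_fst.comp measurable_fst).prodMk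
    ((measurable_snd.comp measurable_fst).add (h1.const_smul τ))

theorem measurable_primal_update (hG : StochasticGradients f P Gx Gy σ) (l : ℝ) (z : Euc d₁)
    (τ : ℝ) :
    Measurable fun p : (Euc d₁ × Euc d₂) × Ξ =>
      (p.1.1 - τ • regularizedGx Gx l z p.1.1 p.1.2 p.2, p.1.2) := by
  exact ((measurable_fst.comp measurable_fst).sub
    ((measurable_regularizedGx hG l z).const_smul τ)).prodMk (measurable_snd.comp measurable_fst)

/-- The state of stochastic AGDA after the dual half-step of iteration `k`. -/
def stochAGDAHalf (Gx : Euc d₁ → Euc d₂ → Ξ → Euc d₁) (Gy : Euc d₁ → Euc d₂ → Ξ → Euc d₂)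
    (τ₁ τ₂ : ℝ) (x₀ : Euc d₁) (y₀ : Euc d₂) (ξ : ℕ × Fin 2 → Ξ) (k : ℕ) : Euc d₁ × Euc d₂ :=
  ((stochAGDA Gx Gy τ₁ τ₂ x₀ y₀ ξ k).1, (stochAGDA Gx Gy τ₁ τ₂ x₀ y₀ ξ k).2
    + τ₂ • Gy (stochAGDA Gx Gy τ₁ τ₂ x₀ y₀ ξ k).1 (stochAGDA Gx Gy τ₁ τ₂ x₀ y₀ ξ k).2 (ξ (k, 0)))

/-- The half-step state sees the sample (k, 0) but not (k, 1), so the latter is still fresh for the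
primal update. -/
theorem measurable_stochAGDA (hG : StochasticGradients f P Gx Gy σ) (τ₁ τ₂ : ℝ) (x₀ : Euc d₁)
    (k : ℕ) :
    Measurable[samplesSigma ξ {i | i.1 < k}] (fun ω =>
        stochAGDA (regularizedGx Gx l z) Gy τ₁ τ₂ x₀ y₀ (fun i => ξ i ω) k) ∧
      Measurable[samplesSigma ξ ({i | i.1 < k} ∪ {(k, 0)})] (fun ω =>
        stochAGDAHalf (regularizedGx Gx l z) Gy τ₁ τ₂ x₀ y₀ (fun i => ξ i ω) k) := by
  have hhalf : ∀ k, Measurable[samplesSigma ξ {i | i.1 < k}] (fun ω =>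
        stochAGDA (regularizedGx Gx l z) Gy τ₁ τ₂ x₀ y₀ (fun i => ξ i ω) k) →
      Measurable[samplesSigma ξ ({i | i.1 < k} ∪ {(k, 0)})] (fun ω =>
        stochAGDAHalf (regularizedGx Gx l z) Gy τ₁ τ₂ x₀ y₀ (fun i => ξ i ω) k) := fun k h => by
    have h1 := h.mono (samplesSigma_mono ξ (t := {i | i.1 < k} ∪ {(k, 0)})
      Set.subset_union_left) le_rfl
    have h2 : Measurable[samplesSigma ξ ({i | i.1 < k} ∪ {(k, 0)})] (ξ (k, 0)) :=
      measurable_samplesSigma ξ (Set.mem_union_right _ rfl)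
    exact (measurable_dual_update hG τ₂).comp (h1.prodMk h2)
  induction k with
  | zero => exact ⟨measurable_const, hhalf 0 measurable_const⟩
  | succ k ih =>
    have hsub : ({i | i.1 < k} ∪ {(k, 0)} : Set (ℕ × Fin 2)) ⊆ {i | i.1 < k + 1} := by
      rintro i (hi | rfl)
      · exact Nat.lt_succ_of_lt hi
      · exact Nat.lt_succ_self k
    have h1 := ih.2.mono (samplesSigma_mono ξ hsub) le_rfl
    have h2 : Measurable[samplesSigma ξ {i : ℕ × Fin 2 | i.1 < k + 1}] (ξ (k, 1)) :=
      measurable_samplesSigma ξ (Nat.lt_succ_self k)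
    have h3 := (measurable_primal_update hG l z τ₁).comp (h1.prodMk h2)
    exact ⟨h3, hhalf (k + 1) h3⟩

variable [MeasurableSpace Ω] {Q : Measure Ω}

theorem lintegral_lyapunov_stochAGDA_le [IsProbabilityMeasure P] [IsProbabilityMeasure Q]
    {m : Euc d₂ → Euc d₁} {xs : Euc d₁}
    (hm : IsRegularizedArgmin f l z m xs) (hf : LipschitzSmooth f l)
    (hp : PLCondition f μ) (hG : StochasticGradients f P Gx Gy σ) (hξ : IIDSamples Q P ξ)
    (hμl : μ ≤ l) (hτ : 0 < τ) (hτl : 18 * (l * τ) ≤ 1) (k : ℕ) :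
    ∫⁻ ω, ENNReal.ofReal (lyapunov f l z m xs (1 / 4)
        (stochAGDA (regularizedGx Gx l z) Gy (6 * τ) τ z y₀ (fun i => ξ i ω) k).1
        (stochAGDA (regularizedGx Gx l z) Gy (6 * τ) τ z y₀ (fun i => ξ i ω) k).2) ∂Q
      ≤ ENNReal.ofReal ((1 - μ * τ) ^ k * lyapunov f l z m xs (1 / 4) z y₀
        + 16 * (l / μ) * τ * σ ^ 2) := by
  have hl := hf.pos
  have hμ := hp.pos
  have hV : ∀ x y, 0 ≤ lyapunov f l z m xs (1 / 4) x y := hm.lyapunov_nonneg hp (by norm_num)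
  have hW : ∀ x y, 0 ≤ lyapunov f l z m xs ((1 - 6 * (l * τ)) / 4) x y :=
    hm.lyapunov_nonneg hp (by linarith [mul_pos hl hτ])
  have hq : 0 ≤ 1 - μ * τ := by
    have : μ * τ ≤ l * τ := mul_le_mul_of_nonneg_right hμl hτ.le
    linarith [mul_pos hl hτ]
  induction k with
  | zero =>
    simp only [stochAGDA, lintegral_const, measure_univ, mul_one, pow_zero, one_mul]
    refine ENNReal.ofReal_le_ofReal (le_add_of_nonneg_right (by positivity))
  | succ k ih =>
    -- The half-steps contribute noise 2lτ²σ² and 14lτ²σ². Their sum is 16lτ²σ², and 16κτσ² is the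
    -- fixed point of the recursion.
    have hdual : ∫⁻ ω, ENNReal.ofReal (lyapunov f l z m xs ((1 - 6 * (l * τ)) / 4)
        (stochAGDAHalf (regularizedGx Gx l z) Gy (6 * τ) τ z y₀ (fun i => ξ i ω) k).1
        (stochAGDAHalf (regularizedGx Gx l z) Gy (6 * τ) τ z y₀ (fun i => ξ i ω) k).2) ∂Q
        ≤ ENNReal.ofReal ((1 - μ * τ) * ((1 - μ * τ) ^ k * lyapunov f l z m xs (1 / 4) z y₀
          + 16 * (l / μ) * τ * σ ^ 2) + 2 * l * τ ^ 2 * σ ^ 2) := by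
      refine (hξ.lintegral_fresh_le (s := {i | i.1 < k}) (i := (k, 0)) (by simp)
        (measurable_stochAGDA hG (6 * τ) τ z k).1
        (ENNReal.measurable_ofReal.comp ((hm.continuous_lyapunov hf _).measurable.comp
          (measurable_dual_update hG τ)))
        (H := fun p => ENNReal.ofReal ((1 - μ * τ) * lyapunov f l z m xs (1 / 4) p.1 p.2
          + 2 * l * τ ^ 2 * σ ^ 2)) fun p => ?_).trans
        (lintegral_ofReal_affine_le (fun ω => hV _ _) hq ?_ (by positivity) ih)
      · obtain ⟨v, hv⟩ := hm.exists_dual_step_le hf hp hμl hτ hτl p.1 p.2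
        refine hG.lintegral_le_of_noise_Gy (x := p.1) (y := p.2) (v := v) (by positivity)
          (fun u => hW _ _) fun u => ?_
        simpa using hv (Gy p.1 p.2 u - gradY f p.1 p.2)
      · have := hV z y₀
        positivity
    refine (hξ.lintegral_fresh_le (s := {i | i.1 < k} ∪ {(k, 0)}) (i := (k, 1)) (by simp)
      (measurable_stochAGDA hG (6 * τ) τ z k).2
      (ENNReal.measurable_ofReal.comp ((hm.continuous_lyapunov hf _).measurable.comp
        (measurable_primal_update hG l z (6 * τ))))
      (H := fun p => ENNReal.ofReal (1 * lyapunov f l z m xs ((1 - 6 * (l * τ)) / 4) p.1 p.2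
        + 14 * l * τ ^ 2 * σ ^ 2)) fun p => ?_).trans
      ((lintegral_ofReal_affine_le (fun ω => hW _ _) zero_le_one ?_ (by positivity) hdual).trans
        (ENNReal.ofReal_le_ofReal (le_of_eq ?_)))
    · obtain ⟨v, hv⟩ := hm.exists_primal_step_le hf hτ hτl p.1 p.2
      refine hG.lintegral_le_of_noise_Gx (x := p.1) (y := p.2) (v := v) (by positivity)
        (fun u => hV _ _) fun u => ?_
      have h1 := hv (Gx p.1 p.2 u - gradX f p.1 p.2)
      have h2 : regularizedGradX f l z p.1 p.2 + (Gx p.1 p.2 u - gradX f p.1 p.2)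
          = regularizedGx Gx l z p.1 p.2 u := by
        rw [regularizedGradX, regularizedGx]; abel
      rw [h2] at h1
      rw [one_mul]
      exact h1
    · have := hV z y₀
      positivity
    · field_simp
      ring

/-- Stochastic AGDA on the regularized objective turns a stationary pair into a stationary point
of the primal function. -/
theorem isMeanStationary_stochAGDA [IsProbabilityMeasure P] [IsProbabilityMeasure Q]
    (hf : LipschitzSmooth f l)
    (hp : PLCondition f μ) (hG : StochasticGradients f P Gx Gy σ) (hξ : IIDSamples Q P ξ)
    (hμl : μ ≤ l) (hτ : 0 < τ) (hτl : 18 * (l * τ) ≤ 1) {ε : ℝ}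
    (hst : IsStationaryPair f ε (ε / Real.sqrt (l / μ)) z y₀)
    (hσ : (l / μ) ^ 3 * (l * τ) * σ ^ 2 ≤ ε ^ 2) {k : ℕ}
    (hk : 2 * Real.posLog (l / μ) ≤ (k + 1) * (μ * τ)) :
    IsMeanStationary Q (primal f) (200 * ε) (fun ω =>
      (stochAGDA (regularizedGx Gx l z) Gy (6 * τ) τ z y₀ (fun i => ξ i ω) k).1) := by
  have hl := hf.pos
  have hμ := hp.pos
  obtain ⟨m, xs, hm⟩ := exists_isRegularizedArgmin hf hp z
  have hx : ‖gradX f z y₀‖ ^ 2 ≤ ε ^ 2 := pow_le_pow_left₀ (norm_nonneg _) hst.1 2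
  have hy : l * ‖gradY f z y₀‖ ^ 2 ≤ μ * ε ^ 2 := by
    have h1 := pow_le_pow_left₀ (norm_nonneg _) hst.2 2
    rw [div_pow, Real.sq_sqrt (by positivity), le_div_iff₀ (by positivity)] at h1
    have h2 := mul_le_mul_of_nonneg_left h1 hμ.le
    have h3 : μ * (‖gradY f z y₀‖ ^ 2 * (l / μ)) = l * ‖gradY f z y₀‖ ^ 2 := by field_simp
    linarith
  have hμτ : μ * τ ≤ 1 := by
    have : μ * τ ≤ l * τ := mul_le_mul_of_nonneg_right hμl hτ.le
    linarith [mul_pos hl hτ]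
  have hq : 0 ≤ 1 - μ * τ := by linarith
  have hV : ∀ x y, 0 ≤ lyapunov f l z m xs (1 / 4) x y := hm.lyapunov_nonneg hp (by norm_num)
  set b := (1 - μ * τ) ^ k * lyapunov f l z m xs (1 / 4) z y₀ + 16 * (l / μ) * τ * σ ^ 2 with hb
  have hb0 : 0 ≤ b := by have := hV z y₀; positivity
  have hbε : (l / μ) ^ 2 * l * b ≤ 22 * ε ^ 2 := by
    have h1 := one_sub_pow_mul_sq_le_three hμτ hk
    have h2 := mul_le_mul_of_nonneg_left (hm.lyapunov_init_le hf hp hx hy)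
      (by positivity : 0 ≤ (1 - μ * τ) ^ k * (l / μ) ^ 2)
    have h3 := mul_le_mul_of_nonneg_right h1 (by positivity : 0 ≤ 2 * ε ^ 2)
    rw [hb]
    linarith
  refine ⟨hp.differentiable_primal hf, integrable_and_integral_le_of_lintegral ?_
    (fun ω => sq_nonneg _) (sq_nonneg _) ?_⟩
  · have h1 : Continuous (gradient (primal f)) := by
      refine (LipschitzWith.of_dist_le_mul (K := ⟨l * (1 + 3 * (l / μ)), by positivity⟩)
        fun x y => ?_).continuous
      rw [dist_eq_norm, dist_eq_norm]
      exact hp.lipschitz_gradient_primal hf y x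
    have h2 := ((measurable_stochAGDA (l := l) (z := z) (y₀ := y₀) hG (6 * τ) τ z k).1.mono
      (hξ.samplesSigma_le _) le_rfl).fst
    exact (h1.measurable.comp h2).norm.pow_const 2
  · refine (lintegral_mono fun ω => ENNReal.ofReal_le_ofReal ((hm.norm_gradient_primal_sq_le hf hp
      hμl hx hy _ (stochAGDA (regularizedGx Gx l z) Gy (6 * τ) τ z y₀
        (fun i => ξ i ω) k).2).trans (add_comm _ _).le)).trans
      ((lintegral_ofReal_affine_le (fun ω => hV _ _) (by positivity) hb0 (by positivity)
        (lintegral_lyapunov_stochAGDA_le hm hf hp hG hξ hμl hτ hτl k)).trans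
          (ENNReal.ofReal_le_ofReal ?_))
    nlinarith [sq_nonneg ε]

end AGDA
end

/-! ### The deterministic case as the noiseless one -/

noncomputable section

section Deterministic

variable {d₁ d₂ : ℕ} {f : Euc d₁ → Euc d₂ → ℝ} {l μ : ℝ}

theorem iidSamples_unit (ι : Type*) :
    IIDSamples (Measure.dirac ()) (Measure.dirac ()) (fun (_ : ι) (_ : Unit) => ()) where
  measurable _ := measurable_const
  law _ := Measure.map_id
  indep := by
    refine iIndepFun_iff_measure_inter_preimage_eq_mul.mpr fun s A _ => ?_
    classical
    simp only [Measure.dirac_apply]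
    rw [Set.indicator_apply]
    simp_rw [Set.indicator_apply, Pi.one_apply]
    rw [Finset.prod_boole]
    simp only [Set.mem_iInter, Set.mem_preimage]

theorem LipschitzSmooth.stochasticGradients_unit (hf : LipschitzSmooth f l) :
    StochasticGradients f (Measure.dirac ()) (fun x y _ => gradX f x y)
      (fun x y _ => gradY f x y) 0 where
  measurable_Gx := hf.continuous_gradX.measurable.comp
    (f := fun p : Euc d₁ × Euc d₂ × Unit => (p.1, p.2.1)) (by fun_prop)
  measurable_Gy := hf.continuous_gradY.measurable.comp
    (f := fun p : Euc d₁ × Euc d₂ × Unit => (p.1, p.2.1)) (by fun_prop)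
  integrable_Gx _ _ := integrable_const _
  integrable_Gy _ _ := integrable_const _
  unbiased_Gx _ _ := by simp
  unbiased_Gy _ _ := by simp
  integrable_sq_Gx _ _ := integrable_const _
  integrable_sq_Gy _ _ := integrable_const _
  variance_Gx _ _ := by simp
  variance_Gy _ _ := by simp

theorem stochGradientAscent_unit (f : Euc d₁ → Euc d₂ → ℝ) (x : Euc d₁) (τ : ℝ) (y₀ : Euc d₂)
    (k : ℕ) :
    stochGradientAscent (fun x y (_ : Unit) => gradY f x y) x τ y₀ (fun _ => ()) k
      = gradientAscent f x τ y₀ k := by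
  induction k with
  | zero => rfl
  | succ k ih => rw [stochGradientAscent, gradientAscent, ih]

theorem LipschitzSmooth.stochAGDA_unit (hf : LipschitzSmooth f l) (z : Euc d₁) (τ₁ τ₂ : ℝ)
    (x₀ : Euc d₁) (y₀ : Euc d₂) (k : ℕ) :
    stochAGDA (regularizedGx (fun x y (_ : Unit) => gradX f x y) l z)
        (fun x y (_ : Unit) => gradY f x y) τ₁ τ₂ x₀ y₀ (fun _ => ()) k
      = agda (regularized f l z) τ₁ τ₂ x₀ y₀ k := by
  induction k with
  | zero => rfl
  | succ k ih =>
    rw [stochAGDA, agda, ih, stochAGDAStep, agdaStep, hf.gradX_regularized, gradY_regularized]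
    rfl

/-- Gradient ascent turns a stationary point of the primal function into a stationary pair. -/
theorem isStationaryPair_gradientAscent (hf : LipschitzSmooth f l) (hp : PLCondition f μ)
    (hμl : μ ≤ l) {τ : ℝ} (hτ : 0 < τ) (hτl : l * τ ≤ 1) {ε ε' : ℝ} (hε : 0 < ε) {x : Euc d₁}
    {y₀ : Euc d₂} (hx : ‖gradient (primal f) x‖ ≤ ε) (hy : ‖gradY f x y₀‖ ≤ ε') {k : ℕ}
    (hk : 2 * Real.posLog (l / μ * ε' / ε) ≤ (k + 1) * (μ * τ)) :
    IsStationaryPair f (200 * ε) (200 * ε) x (gradientAscent f x τ y₀ k) := by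
  obtain ⟨⟨-, h1⟩, -, h2⟩ := isMeanStationaryPair_stochGradientAscent hf hp
    hf.stochasticGradients_unit (iidSamples_unit ℕ) hμl hτ hτl hε hx hy
    (by rw [zero_pow two_ne_zero, mul_zero]; positivity) hk
  simp only [stochGradientAscent_unit, integral_const, probReal_univ, one_smul] at h1 h2
  exact ⟨le_of_sq_le_sq h1 (by positivity), le_of_sq_le_sq h2 (by positivity)⟩

/-- AGDA on the regularized objective turns a stationary pair into a stationary point of the
primal function. -/
theorem isStationaryPt_agda (hf : LipschitzSmooth f l) (hp : PLCondition f μ) (hμl : μ ≤ l)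
    {τ : ℝ} (hτ : 0 < τ) (hτl : 18 * (l * τ) ≤ 1) {ε : ℝ} (hε : 0 < ε) {z : Euc d₁} {y₀ : Euc d₂}
    (hst : IsStationaryPair f ε (ε / Real.sqrt (l / μ)) z y₀) {k : ℕ}
    (hk : 2 * Real.posLog (l / μ) ≤ (k + 1) * (μ * τ)) :
    IsStationaryPt (primal f) (200 * ε) (agda (regularized f l z) (6 * τ) τ z y₀ k).1 := by
  obtain ⟨h1, -, h2⟩ := isMeanStationary_stochAGDA hf hp
    hf.stochasticGradients_unit (iidSamples_unit (ℕ × Fin 2)) hμl hτ hτl hst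
    (by rw [zero_pow two_ne_zero, mul_zero]; positivity) hk
  simp only [hf.stochAGDA_unit, integral_const, probReal_univ, one_smul] at h2
  exact ⟨h1, le_of_sq_le_sq h2 (by positivity)⟩

end Deterministic

/-! ### Step sizes and the final bounds -/

/-- The step size `1 / (l (c + s))`, where `s` measures the noise, and its iteration count. -/
theorem stepSize_spec {l μ c s : ℝ} (hl : 0 < l) (hμ : 0 < μ) (hc : 1 ≤ c) (hs : 0 ≤ s) :
    0 < 1 / (l * (c + s)) ∧ c * (l * (1 / (l * (c + s)))) ≤ 1 ∧
      s * (l * (1 / (l * (c + s)))) ≤ 1 ∧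
      ∀ (L : ℝ) (k : ℕ), ⌊2 * (l / μ) * (c + s) * L⌋₊ ≤ k →
        2 * L ≤ (k + 1) * (μ * (1 / (l * (c + s)))) := by
  have hcs : 0 < c + s := by linarith
  have h1 : l * (1 / (l * (c + s))) = 1 / (c + s) := by field_simp
  refine ⟨by positivity, ?_, ?_, fun L k hk => ?_⟩
  · rw [h1, mul_one_div, div_le_one hcs]; linarith
  · rw [h1, mul_one_div, div_le_one hcs]; linarith
  · have h2 := Nat.lt_floor_add_one (2 * (l / μ) * (c + s) * L)
    have h3 : (⌊2 * (l / μ) * (c + s) * L⌋₊ : ℝ) ≤ k := Nat.cast_le.mpr hk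
    have h4 : 2 * L = 2 * (l / μ) * (c + s) * L * (μ * (1 / (l * (c + s)))) := by field_simp
    rw [h4]
    exact mul_le_mul_of_nonneg_right (by linarith) (by positivity)

/-- If `l < μ`, then `f` is constant in `y`, and `μ` can be replaced by `l`. -/
theorem LipschitzSmooth.isStationaryPair_of_lt {d₁ d₂ : ℕ} {f : Euc d₁ → Euc d₂ → ℝ} {l μ : ℝ}
    (hf : LipschitzSmooth f l) (hp : PLCondition f μ) (hlμ : l < μ) {ε ε' : ℝ} (hε : 0 < ε)
    {x : Euc d₁} {y : Euc d₂} (h : IsStationaryPair f ε ε' x y) :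
    IsStationaryPair f ε (ε / Real.sqrt (l / l)) x y := by
  refine ⟨h.1, ?_⟩
  rw [PLCondition.gradY_eq_zero_of_lt hf hp hlμ, norm_zero]
  positivity

end

theorem proposition1 :
    ∃ C : ℝ, 0 < C ∧ ∀ l μ : ℝ, 0 < l → 0 < μ → ∀ κ : ℝ, κ = l / μ →
      -- the primal function is differentiable
      (∀ (d₁ d₂ : ℕ) (f : Euc d₁ → Euc d₂ → ℝ),
        LipschitzSmooth f l → PLCondition f μ → Differentiable ℝ (primal f)) ∧
      -- (a), gradient ascent
      (∀ ε ε' : ℝ, 0 < ε →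
        ∃ (τ : ℝ) (K : ℕ), 0 < τ ∧ (K : ℝ) ≤ C * (κ * Real.posLog (κ * ε' / ε)) ∧
          ∀ (d₁ d₂ : ℕ) (f : Euc d₁ → Euc d₂ → ℝ) (xh : Euc d₁) (yt : Euc d₂),
            LipschitzSmooth f l → PLCondition f μ →
            IsStationaryPt (primal f) ε xh → ‖gradY f xh yt‖ ≤ ε' →
            ∀ k : ℕ, K ≤ k →
              IsStationaryPair f (C * ε) (C * ε) xh (gradientAscent f xh τ yt k)) ∧
      -- (a), stochastic gradient ascent
      (∀ ε ε' σ : ℝ, 0 < ε → 0 ≤ σ →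
        ∃ (τ : ℝ) (K : ℕ), 0 < τ ∧
          (K : ℝ) ≤ C * ((κ + κ ^ 3 * σ ^ 2 / ε ^ 2) * Real.posLog (κ * ε' / ε)) ∧
          ∀ (d₁ d₂ : ℕ) (f : Euc d₁ → Euc d₂ → ℝ) (xh : Euc d₁) (yt : Euc d₂)
            (Ξ : Type*) [MeasurableSpace Ξ] (P : Measure Ξ) [IsProbabilityMeasure P]
            (Gx : Euc d₁ → Euc d₂ → Ξ → Euc d₁) (Gy : Euc d₁ → Euc d₂ → Ξ → Euc d₂)
            (Ω : Type*) [MeasurableSpace Ω] (Q : Measure Ω) [IsProbabilityMeasure Q]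
            (ξ : ℕ → Ω → Ξ),
            LipschitzSmooth f l → PLCondition f μ →
            StochasticGradients f P Gx Gy σ → IIDSamples Q P ξ →
            IsStationaryPt (primal f) ε xh → ‖gradY f xh yt‖ ≤ ε' →
            ∀ k : ℕ, K ≤ k →
              IsMeanStationaryPair Q f (C * ε) (C * ε) (fun _ => xh)
                (fun ω => stochGradientAscent Gy xh τ yt (fun i => ξ i ω) k)) ∧
      -- (b), AGDA
      (∀ ε : ℝ, 0 < ε →
        ∃ (τ₁ τ₂ : ℝ) (K : ℕ), 0 < τ₁ ∧ 0 < τ₂ ∧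
          2 * (K : ℝ) ≤ C * (κ * Real.posLog κ) ∧
          ∀ (d₁ d₂ : ℕ) (f : Euc d₁ → Euc d₂ → ℝ) (xt : Euc d₁) (yt : Euc d₂),
            LipschitzSmooth f l → PLCondition f μ →
            IsStationaryPair f ε (ε / Real.sqrt κ) xt yt →
            ∀ k : ℕ, K ≤ k →
              IsStationaryPt (primal f) (C * ε)
                (agda (regularized f l xt) τ₁ τ₂ xt yt k).1) ∧
      -- (b), stochastic AGDA
      (∀ ε σ : ℝ, 0 < ε → 0 ≤ σ →
        ∃ (τ₁ τ₂ : ℝ) (K : ℕ), 0 < τ₁ ∧ 0 < τ₂ ∧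
          2 * (K : ℝ) ≤ C * ((κ + κ ^ 5 * σ ^ 2 / ε ^ 2) * Real.posLog κ) ∧
          ∀ (d₁ d₂ : ℕ) (f : Euc d₁ → Euc d₂ → ℝ) (xt : Euc d₁) (yt : Euc d₂)
            (Ξ : Type*) [MeasurableSpace Ξ] (P : Measure Ξ) [IsProbabilityMeasure P]
            (Gx : Euc d₁ → Euc d₂ → Ξ → Euc d₁) (Gy : Euc d₁ → Euc d₂ → Ξ → Euc d₂)
            (Ω : Type*) [MeasurableSpace Ω] (Q : Measure Ω) [IsProbabilityMeasure Q]
            (ξ : ℕ × Fin 2 → Ω → Ξ),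
            LipschitzSmooth f l → PLCondition f μ →
            StochasticGradients f P Gx Gy σ → IIDSamples Q P ξ →
            IsStationaryPair f ε (ε / Real.sqrt κ) xt yt →
            ∀ k : ℕ, K ≤ k →
              IsMeanStationary Q (primal f) (C * ε)
                (fun ω => (stochAGDA (regularizedGx Gx l xt) Gy τ₁ τ₂ xt yt
                  (fun i => ξ i ω) k).1)) := by
  -- The most demanding requirement is 512·22 + 16 = 11280 ≤ C², from AGDA; the iteration counts
  -- need only C ≥ 72.
  refine ⟨200, by norm_num, fun l μ hl hμ κ hκ => ?_⟩
  subst hκ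
  refine ⟨fun d₁ d₂ f hf hp => hp.differentiable_primal hf, ?_, ?_, ?_, ?_⟩
  · intro ε ε' hε
    rcases le_or_gt μ l with hμl | hlμ
    · obtain ⟨h1, h2, -, h3⟩ := stepSize_spec hl hμ le_rfl le_rfl
      rw [one_mul] at h2
      have hL : 0 ≤ Real.posLog (l / μ * ε' / ε) := Real.posLog_nonneg
      refine ⟨_, ⌊2 * (l / μ) * (1 + 0) * Real.posLog (l / μ * ε' / ε)⌋₊, h1,
        (Nat.floor_le (by positivity)).trans ?_, ?_⟩
      · have : 0 ≤ l / μ * Real.posLog (l / μ * ε' / ε) := by positivity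
        linarith
      · intro d₁ d₂ f xh yt hf hp hx hy k hk
        exact isStationaryPair_gradientAscent hf hp hμl h1 h2 hε hx.2 hy (h3 _ k hk)
    · obtain ⟨h1, h2, -, -⟩ := stepSize_spec hl hl le_rfl le_rfl
      rw [one_mul] at h2
      have hL : 0 ≤ Real.posLog (l / μ * ε' / ε) := Real.posLog_nonneg
      refine ⟨_, 0, h1, by rw [Nat.cast_zero]; positivity, ?_⟩
      intro d₁ d₂ f xh yt hf hp hx hy k hk
      -- With μ replaced by l the condition number is 1, and the y-gradient is zero, so the
      -- logarithm vanishes and K = 0 works.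
      refine isStationaryPair_gradientAscent (ε' := 0) hf (hp.mono hl hlμ.le) le_rfl h1 h2 hε hx.2
        (by rw [hp.gradY_eq_zero_of_lt hf hlμ, norm_zero]) ?_
      rw [mul_zero, zero_div, Real.posLog_zero, mul_zero]
      positivity
  · intro ε ε' σ hε hσ
    rcases le_or_gt μ l with hμl | hlμ
    · obtain ⟨h1, h2, h2', h3⟩ := stepSize_spec hl hμ le_rfl
        (by positivity : 0 ≤ (l / μ) ^ 2 * σ ^ 2 / ε ^ 2)
      rw [one_mul] at h2
      have hL : 0 ≤ Real.posLog (l / μ * ε' / ε) := Real.posLog_nonneg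
      refine ⟨_, ⌊2 * (l / μ) * (1 + (l / μ) ^ 2 * σ ^ 2 / ε ^ 2)
        * Real.posLog (l / μ * ε' / ε)⌋₊, h1, (Nat.floor_le (by positivity)).trans ?_, ?_⟩
      · have h4 : 2 * (l / μ) * (1 + (l / μ) ^ 2 * σ ^ 2 / ε ^ 2) * Real.posLog (l / μ * ε' / ε)
            = 2 * ((l / μ + (l / μ) ^ 3 * σ ^ 2 / ε ^ 2)
              * Real.posLog (l / μ * ε' / ε)) := by ring
        rw [h4]
        exact mul_le_mul_of_nonneg_right (by norm_num) (by positivity)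
      · intro d₁ d₂ f xh yt Ξ _ P _ Gx Gy Ω _ Q _ ξ hf hp hG hξ hx hy k hk
        refine isMeanStationaryPair_stochGradientAscent hf hp hG hξ hμl h1 h2 hε hx.2 hy ?_
          (h3 _ k hk)
        have h4 := mul_le_mul_of_nonneg_right h2' (sq_nonneg ε)
        rw [div_mul_eq_mul_div, div_mul_cancel₀ _ (pow_ne_zero 2 hε.ne')] at h4
        linarith
    · obtain ⟨h1, h2, h2', -⟩ := stepSize_spec hl hl le_rfl
        (by positivity : 0 ≤ σ ^ 2 / ε ^ 2)
      rw [one_mul] at h2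
      have hL : 0 ≤ Real.posLog (l / μ * ε' / ε) := Real.posLog_nonneg
      refine ⟨_, 0, h1, by rw [Nat.cast_zero]; positivity, ?_⟩
      intro d₁ d₂ f xh yt Ξ _ P _ Gx Gy Ω _ Q _ ξ hf hp hG hξ hx hy k hk
      refine isMeanStationaryPair_stochGradientAscent (ε' := 0) hf (hp.mono hl hlμ.le) hG hξ le_rfl
        h1 h2 hε hx.2 (by rw [hp.gradY_eq_zero_of_lt hf hlμ, norm_zero]) ?_ ?_
      · have h4 := mul_le_mul_of_nonneg_right h2' (sq_nonneg ε)
        rw [div_mul_eq_mul_div, div_mul_cancel₀ _ (pow_ne_zero 2 hε.ne')] at h4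
        rw [div_self hl.ne', one_pow]
        linarith
      · rw [mul_zero, zero_div, Real.posLog_zero, mul_zero]
        positivity
  · intro ε hε
    have hL : 0 ≤ Real.posLog (l / μ) := Real.posLog_nonneg
    rcases le_or_gt μ l with hμl | hlμ
    · obtain ⟨h1, h2, -, h3⟩ := stepSize_spec hl hμ (by norm_num : (1 : ℝ) ≤ 18) le_rfl
      refine ⟨_, _, ⌊2 * (l / μ) * (18 + 0) * Real.posLog (l / μ)⌋₊,
        mul_pos (by norm_num : (0 : ℝ) < 6) h1, h1,
        (mul_le_mul_of_nonneg_left (Nat.floor_le (by positivity)) zero_le_two).trans ?_, ?_⟩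
      · have : 0 ≤ l / μ * Real.posLog (l / μ) := by positivity
        linarith
      · intro d₁ d₂ f xt yt hf hp hst k hk
        exact isStationaryPt_agda hf hp hμl h1 h2 hε hst (h3 _ k hk)
    · obtain ⟨h1, h2, -, -⟩ := stepSize_spec hl hl (by norm_num : (1 : ℝ) ≤ 18) le_rfl
      refine ⟨_, _, 0, mul_pos (by norm_num : (0 : ℝ) < 6) h1, h1,
        by rw [Nat.cast_zero, mul_zero]; positivity, ?_⟩
      intro d₁ d₂ f xt yt hf hp hst k hk
      refine isStationaryPt_agda hf (hp.mono hl hlμ.le) le_rfl h1 h2 hε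
        (hf.isStationaryPair_of_lt hp hlμ hε hst) ?_
      rw [div_self hl.ne', Real.posLog_one, mul_zero]
      positivity
  · intro ε σ hε hσ
    have hL : 0 ≤ Real.posLog (l / μ) := Real.posLog_nonneg
    rcases le_or_gt μ l with hμl | hlμ
    · have hκ1 : 1 ≤ l / μ := by rwa [le_div_iff₀ hμ, one_mul]
      obtain ⟨h1, h2, h2', h3⟩ := stepSize_spec hl hμ (by norm_num : (1 : ℝ) ≤ 18)
        (by positivity : 0 ≤ (l / μ) ^ 3 * σ ^ 2 / ε ^ 2)
      refine ⟨_, _, ⌊2 * (l / μ) * (18 + (l / μ) ^ 3 * σ ^ 2 / ε ^ 2) * Real.posLog (l / μ)⌋₊,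
        mul_pos (by norm_num : (0 : ℝ) < 6) h1, h1,
        (mul_le_mul_of_nonneg_left (Nat.floor_le (by positivity)) zero_le_two).trans ?_, ?_⟩
      · have h4 : 2 * (2 * (l / μ) * (18 + (l / μ) ^ 3 * σ ^ 2 / ε ^ 2) * Real.posLog (l / μ))
            = (72 * (l / μ) + 4 * ((l / μ) ^ 4 * σ ^ 2 / ε ^ 2)) * Real.posLog (l / μ) := by ring
        -- The argument yields the power κ⁴; κ ≥ 1 weakens it to κ⁵.
        have h5 : (l / μ) ^ 4 * σ ^ 2 / ε ^ 2 ≤ (l / μ) ^ 5 * σ ^ 2 / ε ^ 2 := by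
          gcongr
          norm_num
        have h6 : 0 ≤ (l / μ) ^ 5 * σ ^ 2 / ε ^ 2 := by positivity
        rw [h4, ← mul_assoc]
        refine mul_le_mul_of_nonneg_right ?_ hL
        linarith
      · intro d₁ d₂ f xt yt Ξ _ P _ Gx Gy Ω _ Q _ ξ hf hp hG hξ hst k hk
        refine isMeanStationary_stochAGDA hf hp hG hξ hμl h1 h2 hst ?_ (h3 _ k hk)
        have h4 := mul_le_mul_of_nonneg_right h2' (sq_nonneg ε)
        rw [div_mul_eq_mul_div, div_mul_cancel₀ _ (pow_ne_zero 2 hε.ne')] at h4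
        linarith
    · obtain ⟨h1, h2, h2', -⟩ := stepSize_spec hl hl (by norm_num : (1 : ℝ) ≤ 18)
        (by positivity : 0 ≤ σ ^ 2 / ε ^ 2)
      refine ⟨_, _, 0, mul_pos (by norm_num : (0 : ℝ) < 6) h1, h1,
        by rw [Nat.cast_zero, mul_zero]; positivity, ?_⟩
      intro d₁ d₂ f xt yt Ξ _ P _ Gx Gy Ω _ Q _ ξ hf hp hG hξ hst k hk
      refine isMeanStationary_stochAGDA hf (hp.mono hl hlμ.le) hG hξ le_rfl h1 h2
        (hf.isStationaryPair_of_lt hp hlμ hε hst) ?_ ?_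
      · have h4 := mul_le_mul_of_nonneg_right h2' (sq_nonneg ε)
        rw [div_mul_eq_mul_div, div_mul_cancel₀ _ (pow_ne_zero 2 hε.ne')] at h4
        rw [div_self hl.ne', one_pow]
        linarith
      · rw [div_self hl.ne', Real.posLog_one, mul_zero]
        positivity
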